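/- Let $\mathcal{R}=\langle R;+,<,\dots\rangle$ be a first-order structure, in an arbitrary language, that expands a divisible ordered Abelian group $\langle R;+,<\rangle$. "Definable" means definable in $\mathcal{R}$ by a first-order formula with parameters, and "discrete" refers to the order topology of $R$. Suppose that - $\mathcal{R}$ is definably complete: every nonempty definable subset of $R$ that is bounded above in $R$ has a least upper bound in $R$; and - the complete theory $T$ of $\mathcal{R}$ has burden $2$, that is, there is an inp-pattern of depth $\kappa$ for every cardinal $\kappa\le 2$, but none of depth $3$. Here an inp-pattern of depth $\kappa$ (in one variable $x$) consists of formulas $\varphi_i(x;\bar y_i)$ and integers $k_i\ge 1$ for $i<\kappa$, and of tuples $\bar a_{i,j}$ ($i<\kappa$, $j<\omega$) from some model of $T$, such that for each $i$ the formulas $\varphi_i(x;\bar a_{i,j})$, $j<\omega$, are $k_i$-inconsistent (for any $k_i$ distinct indices $j$, their conjunction is inconsistent), and for each $\eta:\kappa\to\omega$ the set $\{\varphi_i(x;\bar a_{i,\eta(i)}) : i<\kappa\}$ is consistent. For a definable discrete set $E\subseteq R$ and a non-maximal element $a$ of $E$ put $S_E(a)=\min\{b\in E : a<b\}$, and let $E'=\{S_E(a)-a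 : a\in E \text{ not maximal}\}$. Call a definable discrete set $E\subseteq R$ pseudo-arithmetic if $S_E(a)$ exists for every non-maximal $a\in E$ and $|E'|=1$. Then every definable discrete set $D\subseteq R$ is the union of a finite set of points and finitely many definable pseudo-arithmetic sets. -/

import Mathlib

universe u v w m

namespace BurdenTwo

section ModelTheory

/-- An inp-pattern in the variables `x̄` (indexed by `α`), with rows indexed by `I` and with
parameters in the structure `M`. A finite set of formulas over `M` is consistent (with the
elementary diagram of `M`) iff it is realized in `M`, and, by compactness, a set of formulas over
`M` is consistent iff each of its finite subsets is realized in `M`; this is how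
(in)consistency is spelled out below. As usual, "`k`-inconsistent" refers to any `k` distinct
indices of the row. -/
structure InpPattern (L : FirstOrder.Language.{u, v}) (M : Type*) [L.Structure M] (α : Type*) (I : Type*) where
  /-- the length of the parameter tuple `ȳ` in row `i` -/
  arity : I → ℕ
  /-- the formula `φ_i(x̄; ȳ)` of row `i` -/
  formula : ∀ i : I, L.Formula (α ⊕ Fin (arity i))
  /-- the positive integer `k_i` -/
  k : I → ℕ
  k_pos : ∀ i, 0 < k i
  /-- the parameters `a_{i,j}` -/
  param : ∀ i : I, ℕ → Fin (arity i) → M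
  row_inconsistent : ∀ (i : I) (J : Finset ℕ), J.card = k i →
    ¬ ∃ x : α → M, ∀ j ∈ J, (formula i).Realize (Sum.elim x (param i j))
  path_consistent : ∀ (η : I → ℕ) (S : Finset I),
    ∃ x : α → M, ∀ i ∈ S, (formula i).Realize (Sum.elim x (param i (η i)))

/-- There is an inp-pattern of depth `κ` in a single variable, with parameters in some model
of `T`. (By the downward Löwenheim–Skolem theorem, larger universes for the model would give
nothing new.) -/
def HasInpPattern {L : FirstOrder.Language.{u, v}} (T : L.Theory) (κ : Cardinal.{w}) : Prop :=
  ∃ (M : FirstOrder.Language.Theory.ModelType.{u, v, max u v w} T) (I : Type w),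
    Cardinal.mk I = κ ∧ Nonempty (InpPattern L M (Fin 1) I)

/-- `T` has burden less than `κ`. -/
def BurdenLT {L : FirstOrder.Language.{u, v}} (T : L.Theory) (κ : Cardinal.{w}) : Prop :=
  ¬ HasInpPattern T κ

/-- `T` has burden `μ`: the least `κ` such that `T` has burden less than `κ` is `μ⁺`. -/
def HasBurden {L : FirstOrder.Language.{u, v}} (T : L.Theory) (μ : Cardinal.{w}) : Prop :=
  IsLeast {κ : Cardinal.{w} | BurdenLT T κ} (Order.succ μ)

/-- The `L`-structure `R` is an expansion of `⟨R; +, <⟩`: some binary function symbol of `L` is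
interpreted by `+`, and some binary relation symbol by `<`. -/
def ExpandsAddLT (L : FirstOrder.Language.{u, v}) (R : Type m) [L.Structure R] [Add R] [LT R] : Prop :=
  (∃ f : L.Functions 2, ∀ x y : R, FirstOrder.Language.Structure.funMap f ![x, y] = x + y) ∧
  (∃ r : L.Relations 2, ∀ x y : R, FirstOrder.Language.Structure.RelMap r ![x, y] ↔ x < y)

/-- `X ⊆ R` is definable in the `L`-structure `R`, with arbitrary parameters. -/
def IsDefinable (L : FirstOrder.Language.{u, v}) {R : Type m} [L.Structure R] (X : Set R) : Prop :=
  (Set.univ : Set R).Definable₁ L X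

/-- Every nonempty definable subset of `R` with an upper bound has a least upper bound. -/
def IsDefinablyComplete (L : FirstOrder.Language.{u, v}) (R : Type m) [L.Structure R] [LinearOrder R] :
    Prop :=
  ∀ X : Set R, IsDefinable L X → X.Nonempty → BddAbove X → ∃ s : R, IsLUB X s

end ModelTheory

section OrderedGroups

/-- The additive group `R` is divisible. -/
def IsDivisible (R : Type m) [AddCommGroup R] : Prop :=
  ∀ n : ℕ, 0 < n → ∀ g : R, ∃ h : R, n • h = g

variable {R : Type m} [LinearOrder R]

/-- `b = S_D(a)`: `b` is the least element of `D` greater than `a`. -/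
def IsSucc (D : Set R) (a b : R) : Prop :=
  IsLeast {c : R | c ∈ D ∧ a < c} b

/-- The difference set `D' = {S_D(a) - a : a ∈ D not maximal}`. -/
def diffSet [AddCommGroup R] (D : Set R) : Set R :=
  {d : R | ∃ a ∈ D, ∃ b : R, IsSucc D a b ∧ d = b - a}

/-- A discrete set `E` on which the successor function `S_E` is defined (at all non-maximal
elements) is pseudo-arithmetic if `|E'| = 1`. -/
def IsPseudoArithmetic [AddCommGroup R] [TopologicalSpace R] (E : Set R) : Prop :=
  IsDiscrete E ∧ (∀ a ∈ E, ¬ IsGreatest E a → ∃ b : R, IsSucc E a b) ∧ (diffSet E).encard = 1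

end OrderedGroups

end BurdenTwo

/-! The only consequence of burden 2 that matters is the absence of depth-3 inp-patterns. It forbids
uniformly definable direct sums `A₀ + A₁ + A₂` of three arbitrarily large sets
(`false_of_direct_sums`), and this obstruction is applied twice.

First, a definable set of isolated positive points accumulating at `0` would give such sums, with
summands taken at three widely separated scales. With definable completeness, bounded nonempty
definable subsets of a definable discrete set `D` therefore have a least and a greatest element, so
one can argue by definable induction along `D`.

Second, call two points of `D` equivalent if `D` looks the same on the windows of length `t` above
them. Long gaps in a class, differences of `D` shorter than those gaps, and a tiny interval `(0, δ)`
form a direct sum. So, uniformly in the gap length, either the long gaps or the short differences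
are few (`exists_encard_lt`). This yields a scale `K` (`exists_scale`) at which there are finitely
many window types of length `K + K` and every type recurs within distance `K`, except above a finite
"bad" set.

Finally, the distance to the next point with the same window does not change from a point of `D` to
its successor as long as both are good (`IsReturnTime.eq_of_isSucc`), by an overlapping-periods
argument. Cutting `D` by window type and by the bad points gives finitely many pieces, each a single
point or pseudo-arithmetic. -/

open FirstOrder Language

namespace BurdenTwo

/-! ### Compactness: from finite grids to inp-patterns -/

section Patterns

/-- A uniform finite version of an inp-pattern of depth `3` in a structure yields an inp-pattern of
depth `3` for its complete theory, by compactness. -/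
theorem hasInpPattern_three_of_finite_grids {L : FirstOrder.Language.{u, v}} {R : Type m}
    [L.Structure R] [Nonempty R] (n : Fin 3 → ℕ) (φ : ∀ i, L.Formula (Fin 1 ⊕ Fin (n i)))
    (h : ∀ N : ℕ, ∃ a : ∀ i : Fin 3, ℕ → Fin (n i) → R,
      (∀ i, ∀ j < N, ∀ j' < N, j ≠ j' → ¬ ∃ x : Fin 1 → R,
        (φ i).Realize (Sum.elim x (a i j)) ∧ (φ i).Realize (Sum.elim x (a i j'))) ∧
      ∀ η : Fin 3 → ℕ, (∀ i, η i < N) →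
        ∃ x : Fin 1 → R, ∀ i, (φ i).Realize (Sum.elim x (a i (η i)))) :
    HasInpPattern (L.completeTheory R) (Cardinal.mk (Fin 3)) := by
  classical
  let C : Type := (i : Fin 3) × (ℕ × Fin (n i))
  let ψ : ∀ i : Fin 3, ℕ → L.Formula (C ⊕ Fin 1) := fun i j =>
    (φ i).relabel (Sum.elim Sum.inr (fun k => Sum.inl ⟨i, j, k⟩))
  have hψ : ∀ (M : Type (max u v)) [L.Structure M] (c : C → M) (x : Fin 1 → M) i j,
      (ψ i j).Realize (Sum.elim c x) ↔ (φ i).Realize (Sum.elim x (fun k => c ⟨i, j, k⟩)) := by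
    intro M _ c x i j
    simp only [ψ, Formula.realize_relabel]
    apply iff_of_eq
    congr 1
    ext (k | k) <;> rfl
  have hψ' : ∀ (c : C → R) (x : Fin 1 → R) i j,
      (ψ i j).Realize (Sum.elim c x) ↔ (φ i).Realize (Sum.elim x (fun k => c ⟨i, j, k⟩)) := by
    intro c x i j
    simp only [ψ, Formula.realize_relabel]
    apply iff_of_eq
    congr 1
    ext (k | k) <;> rfl
  let rowS : Fin 3 → ℕ → ℕ → L.Formula C := fun i j j' => ((ψ i j ⊓ ψ i j').iExs (Fin 1)).not
  let pathS : (Fin 3 → ℕ) → L.Formula C := fun η =>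
    (Formula.iInf (fun i => ψ i (η i))).iExs (Fin 1)
  -- `T N` demands the grid conditions for indices below `N` only. These theories increase with `N`,
  -- so their union is satisfiable once each of them is.
  let T : ℕ → L[[C]].Theory := fun N =>
    (L.lhomWithConstants C).onTheory (L.completeTheory R) ∪
      ({s | ∃ i, ∃ j < N, ∃ j' < N, j ≠ j' ∧ s = Formula.equivSentence (rowS i j j')} ∪
       {s | ∃ η : Fin 3 → ℕ, (∀ i, η i < N) ∧ s = Formula.equivSentence (pathS η)})
  have hT : Monotone T := by
    intro N N' hN
    refine Set.union_subset_union_right _ (Set.union_subset_union ?_ ?_)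
    · rintro s ⟨i, j, hj, j', hj', hne, rfl⟩
      exact ⟨i, j, hj.trans_le hN, j', hj'.trans_le hN, hne, rfl⟩
    · rintro s ⟨η, hη, rfl⟩
      exact ⟨η, fun i => (hη i).trans_le hN, rfl⟩
  have hsat : Theory.IsSatisfiable (⋃ N, T N) := by
    rw [Theory.isSatisfiable_directed_union_iff hT.directed_le]
    intro N
    obtain ⟨a, ha1, ha2⟩ := h N
    let : (constantsOn C).Structure R := constantsOn.structure (fun c => a c.1 c.2.1 c.2.2)
    have hcon : ∀ c : C, ((L.con c : L[[C]].Constants) : R) = a c.1 c.2.1 c.2.2 := fun c => rfl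
    have : R ⊨ T N := by
      refine Theory.model_union_iff.2 ⟨(LHom.onTheory_model _ _).2 inferInstance,
        Theory.model_union_iff.2 ⟨⟨?_⟩, ⟨?_⟩⟩⟩
      · rintro s ⟨i, j, hj, j', hj', hne, rfl⟩
        rw [Formula.realize_equivSentence]
        simp only [rowS, Formula.realize_not, Formula.realize_iExs, Formula.realize_inf, hψ']
        exact ha1 i j hj j' hj' hne
      · rintro s ⟨η, hη, rfl⟩
        rw [Formula.realize_equivSentence]
        simp only [pathS, Formula.realize_iExs, Formula.realize_iInf, hψ']
        exact ha2 η hη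
    exact Theory.Model.isSatisfiable R
  obtain ⟨M⟩ := hsat
  have hM0 : (L.lhomWithConstants C).onTheory (L.completeTheory R) ⊆ ⋃ N, T N :=
    Set.subset_union_left.trans (Set.subset_iUnion T 0)
  let M' := (M.subtheoryModel hM0).reduct (L.lhomWithConstants C)
  let : L.Structure M := (L.lhomWithConstants C).reduct M
  have : (L.lhomWithConstants C).IsExpansionOn M := LHom.isExpansionOn_reduct _ _
  refine ⟨M', Fin 3, rfl, ⟨⟨n, φ, fun _ => 2, fun _ => two_pos,
    fun i j k => ((L.con (⟨i, j, k⟩ : C) : L[[C]].Constants) : M), ?_, ?_⟩⟩⟩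
  · intro i J hJ
    obtain ⟨j, j', hne, rfl⟩ := Finset.card_eq_two.1 hJ
    have hmem : Formula.equivSentence (rowS i j j') ∈ ⋃ N, T N :=
      Set.mem_iUnion.2 ⟨max j j' + 1, Or.inr (Or.inl ⟨i, j, by omega, j', by omega, hne, rfl⟩)⟩
    have := M.is_model.realize_of_mem _ hmem
    rw [Formula.realize_equivSentence] at this
    simp only [rowS, Formula.realize_not, Formula.realize_iExs, Formula.realize_inf, hψ] at this
    rintro ⟨x, hx⟩
    exact this ⟨x, hx j (by simp), hx j' (by simp)⟩
  · intro η S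
    have hmem : Formula.equivSentence (pathS η) ∈ ⋃ N, T N :=
      Set.mem_iUnion.2 ⟨η 0 + η 1 + η 2 + 1, Or.inr (Or.inr ⟨η, fun i => by
        fin_cases i <;> simp <;> omega, rfl⟩)⟩
    have := M.is_model.realize_of_mem _ hmem
    rw [Formula.realize_equivSentence] at this
    simp only [pathS, Formula.realize_iExs, Formula.realize_iInf, hψ] at this
    obtain ⟨x, hx⟩ := this
    exact ⟨x, fun i _ => hx i⟩

theorem not_hasInpPattern_three {L : FirstOrder.Language.{u, v}} {T : L.Theory}
    (h : HasBurden T (2 : Cardinal.{0})) : ¬ HasInpPattern T (Cardinal.mk (Fin 3)) := by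
  have h1 : BurdenLT T (Order.succ (2 : Cardinal.{0})) := h.1
  have h2 : Order.succ (2 : Cardinal.{0}) = Cardinal.mk (Fin 3) := by
    rw [Cardinal.mk_fin, ← Nat.cast_ofNat (R := Cardinal.{0}) (n := 2), Cardinal.succ_natCast]
    norm_num
  rwa [h2] at h1

end Patterns

/-! ### Closure properties of definable relations and functions -/

section DefinabilityCalculus

variable {L : FirstOrder.Language.{u, v}} {R : Type m} [L.Structure R] {α : Type}

/-- A relation on tuples from `R` is definable with parameters. -/
def DefRel (L : FirstOrder.Language.{u, v}) {R : Type m} [L.Structure R] {α : Type}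
    (P : (α → R) → Prop) : Prop :=
  (Set.univ : Set R).Definable L {v | P v}

/-- A function on tuples from `R` is definable with parameters. -/
def DefFun (L : FirstOrder.Language.{u, v}) {R : Type m} [L.Structure R] {α : Type}
    (f : (α → R) → R) : Prop :=
  (Set.univ : Set R).DefinableFun L f

namespace DefRel

theorem and {P Q : (α → R) → Prop} (hP : DefRel L P) (hQ : DefRel L Q) :
    DefRel L fun v => P v ∧ Q v :=
  Set.Definable.inter hP hQ

theorem or {P Q : (α → R) → Prop} (hP : DefRel L P) (hQ : DefRel L Q) :
    DefRel L fun v => P v ∨ Q v :=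
  Set.Definable.union hP hQ

theorem not {P : (α → R) → Prop} (hP : DefRel L P) : DefRel L fun v => ¬ P v :=
  Set.Definable.compl hP

theorem congr {P Q : (α → R) → Prop} (hP : DefRel L P) (h : ∀ v, Q v ↔ P v) : DefRel L Q := by
  rwa [funext fun v => propext (h v)]

theorem imp {P Q : (α → R) → Prop} (hP : DefRel L P) (hQ : DefRel L Q) :
    DefRel L fun v => P v → Q v :=
  (hP.not.or hQ).congr fun _ => imp_iff_not_or

theorem iff {P Q : (α → R) → Prop} (hP : DefRel L P) (hQ : DefRel L Q) :
    DefRel L fun v => P v ↔ Q v :=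
  ((hP.imp hQ).and (hQ.imp hP)).congr fun _ => iff_iff_implies_and_implies

theorem ex {P : (α → R) → R → Prop}
    (h : DefRel L fun w : α ⊕ Fin 1 → R => P (fun a => w (Sum.inl a)) (w (Sum.inr 0))) :
    DefRel L fun v => ∃ x, P v x := by
  refine DefRel.congr (Set.Definable.exists_of_finite h) fun v => ⟨?_, ?_⟩
  · rintro ⟨x, hx⟩
    exact ⟨fun _ => x, hx⟩
  · rintro ⟨x, hx⟩
    exact ⟨x 0, hx⟩

theorem all {P : (α → R) → R → Prop}
    (h : DefRel L fun w : α ⊕ Fin 1 → R => P (fun a => w (Sum.inl a)) (w (Sum.inr 0))) :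
    DefRel L fun v => ∀ x, P v x :=
  (ex (P := fun v x => ¬ P v x) h.not).not.congr fun v => by simp

theorem subst {β : Type} [Finite β] {P : (β → R) → Prop} (hP : DefRel L P)
    {f : β → (α → R) → R} (hf : ∀ b, DefFun L (f b)) : DefRel L fun v => P fun b => f b v :=
  Set.Definable.preimage_map (F := fun v b => f b v) hf hP

theorem eq {f g : (α → R) → R} (hf : DefFun L f) (hg : DefFun L g) :
    DefRel L fun v => f v = g v :=
  hf.ofPred_eq hg

theorem mem {D : Set R} (hD : IsDefinable L D) {f : (α → R) → R} (hf : DefFun L f) :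
    DefRel L fun v => f v ∈ D :=
  Set.Definable.preimage_map (F := fun v (_ : Fin 1) => f v) (fun _ => hf) hD

theorem isDefinable {X : Set R} (h : DefRel L fun v : Fin 1 → R => v 0 ∈ X) : IsDefinable L X := h

end DefRel

namespace DefFun

theorem var (a : α) : DefFun (R := R) L fun v => v a :=
  Set.DefinableFun.proj L

theorem const (r : R) : DefFun (α := α) L fun _ => r :=
  L.definableFun_const α (Set.mem_univ r)

end DefFun

section

variable [AddCommGroup R] [LinearOrder R]

theorem DefRel.lt (h : ExpandsAddLT L R) {f g : (α → R) → R} (hf : DefFun L f) (hg : DefFun L g) :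
    DefRel L fun v => f v < g v := by
  obtain ⟨r, hr⟩ := h.2
  have h0 : DefRel (R := R) L fun v : Fin 2 → R => v 0 < v 1 := by
    have : (∅ : Set R).Definable L {v : Fin 2 → R | v 0 < v 1} := by
      rw [Set.empty_definable_iff]
      refine ⟨r.formula fun i => Term.var i, ?_⟩
      ext v
      simp only [Set.mem_ofPred_eq, Formula.realize_rel, Term.realize_var, ← hr]
      apply iff_of_eq
      congr 1
      ext i
      fin_cases i <;> rfl
    exact this.mono (Set.empty_subset _)
  exact h0.subst (f := ![f, g]) (by intro b; fin_cases b <;> assumption)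

theorem DefRel.le (h : ExpandsAddLT L R) {f g : (α → R) → R} (hf : DefFun L f) (hg : DefFun L g) :
    DefRel L fun v => f v ≤ g v :=
  (DefRel.lt h hg hf).not.congr fun _ => not_lt.symm

theorem DefFun.add [Finite α] (h : ExpandsAddLT L R) {f g : (α → R) → R} (hf : DefFun L f) (hg : DefFun L g) :
    DefFun L fun v => f v + g v := by
  obtain ⟨p, hp⟩ := h.1
  have h0 : (Set.univ : Set R).DefinableFun L (fun v : Fin 2 → R => v 0 + v 1) := by
    have := Set.DefinableFun.of_empty (A := (Set.univ : Set R)) (Set.DefinableFun.fun_symbol (M := R) p)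
    convert this using 2 with v
    rw [← hp]
    congr 1
    ext i
    fin_cases i <;> rfl
  exact Set.DefinableFun.comp (g := fun v => ![f v, g v]) (by intro b; fin_cases b <;> assumption) h0

theorem DefFun.sub [Finite α] (h : ExpandsAddLT L R) {f g : (α → R) → R} (hf : DefFun L f)
    (hg : DefFun L g) : DefFun L fun v => f v - g v := by
  have hs : ∀ {k : (α → R) → R}, DefFun L k → DefFun L fun w : Option α → R => k fun a => w (some a) :=
    fun hk => Set.DefinableFun.comp (g := fun w a => w (some a)) (fun a => DefFun.var (some a)) hk
  exact (DefRel.eq ((DefFun.var none).add h (hs hg)) (hs hf)).congr fun w => by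
    rw [← eq_sub_iff_add_eq]
    exact eq_comm

end

/-- A definition uses only finitely many parameters from `R`. Here `g` appends them to the tuple
`b`, leaving a formula without parameters as inp-patterns require. -/
theorem DefRel.exists_formula {β : Type} [Finite β] {P : (Fin 1 ⊕ β → R) → Prop}
    (hP : DefRel L P) : ∃ (n : ℕ) (g : (β → R) → Fin n → R) (φ : L.Formula (Fin 1 ⊕ Fin n)),
      ∀ x b, P (Sum.elim x b) ↔ φ.Realize (Sum.elim x (g b)) := by
  obtain ⟨A₀, -, hA⟩ := Set.definable_iff_finitely_definable.1 hP
  obtain ⟨φ, hφ⟩ := Set.definable_iff_exists_formula_sum.1 hA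
  obtain ⟨n, ⟨e⟩⟩ := Finite.exists_equiv_fin ((A₀ : Set R) ⊕ β)
  refine ⟨n, fun b i => Sum.elim (fun a : (A₀ : Set R) => (a : R)) b (e.symm i),
    φ.relabel (Sum.elim (fun a => Sum.inr (e (Sum.inl a)))
      (Sum.elim Sum.inl fun b => Sum.inr (e (Sum.inr b)))), fun x b => ?_⟩
  have := Set.ext_iff.1 hφ (Sum.elim x b)
  refine this.trans ?_
  rw [Formula.realize_relabel]
  apply iff_of_eq
  change φ.Realize _ = _
  congr 1
  ext (a | a | a) <;> simp

end DefinabilityCalculus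

attribute [irreducible] DefRel DefFun

/-! ### Direct sums of three large sets are impossible -/

section DirectSums

variable {L : FirstOrder.Language.{u, v}} {R : Type m} [L.Structure R]

/-- In a structure without inp-patterns of depth `3`, three definable families of sets do not
contain arbitrarily large finite grids of consistent rows of pairwise disjoint sets. -/
theorem false_of_finite_grids [Nonempty R]
    (hT : ¬ HasInpPattern (L.completeTheory R) (Cardinal.mk (Fin 3)))
    {β : Type} [Finite β] (P : Fin 3 → (Fin 1 ⊕ β → R) → Prop) (hP : ∀ i, DefRel L (P i))
    (h : ∀ N : ℕ, ∃ a : Fin 3 → ℕ → β → R,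
      (∀ i, ∀ j < N, ∀ j' < N, j ≠ j' → ¬ ∃ x : Fin 1 → R,
        P i (Sum.elim x (a i j)) ∧ P i (Sum.elim x (a i j'))) ∧
      ∀ η : Fin 3 → ℕ, (∀ i, η i < N) →
        ∃ x : Fin 1 → R, ∀ i, P i (Sum.elim x (a i (η i)))) : False := by
  choose n g φ hφ using fun i => (hP i).exists_formula
  refine hT (hasInpPattern_three_of_finite_grids n φ fun N => ?_)
  obtain ⟨a, h1, h2⟩ := h N
  refine ⟨fun i j => g i (a i j), ?_, ?_⟩
  · simpa only [hφ] using h1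
  · simpa only [hφ] using h2

theorem exists_injOn_of_le_encard {X : Type*} [Nonempty X] {N : ℕ} {s : Set X}
    (h : (N : ℕ∞) ≤ s.encard) :
    ∃ f : ℕ → X, (∀ j < N, f j ∈ s) ∧ ∀ j < N, ∀ j' < N, f j = f j' → j = j' := by
  obtain ⟨t, hts, ht⟩ := Set.exists_subset_encard_eq h
  have hf : t.Finite := Set.finite_of_encard_eq_coe ht
  have hc : hf.toFinset.card = N := by
    rw [hf.encard_eq_coe_toFinset_card] at ht
    exact_mod_cast ht
  let e := hf.toFinset.equivFinOfCardEq hc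
  obtain ⟨x₀⟩ := ‹Nonempty X›
  refine ⟨fun j => if hj : j < N then e.symm ⟨j, hj⟩ else x₀, fun j hj => ?_, fun j hj j' hj' h => ?_⟩
  · simp only [hj, dif_pos]
    exact hts (hf.mem_toFinset.1 (e.symm ⟨j, hj⟩).2)
  · simp only [hj, hj', dif_pos] at h
    simpa using e.symm.injective (Subtype.ext h)

/-- In a structure without inp-patterns of depth `3`, there are no uniformly definable direct sums
of three arbitrarily large sets. -/
theorem false_of_direct_sums [AddCommGroup R] [LinearOrder R] (hexp : ExpandsAddLT L R)
    (hT : ¬ HasInpPattern (L.completeTheory R) (Cardinal.mk (Fin 3)))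
    {k : ℕ} (A : Fin 3 → (Fin k → R) → R → Prop)
    (hA : ∀ i, DefRel L fun w : Fin k ⊕ Fin 1 → R => A i (fun i => w (Sum.inl i)) (w (Sum.inr 0)))
    (h : ∀ N : ℕ, ∃ t, (∀ i, (N : ℕ∞) ≤ {x | A i t x}.encard) ∧
      ∀ a b c a' b' c', A 0 t a → A 1 t b → A 2 t c → A 0 t a' → A 1 t b' → A 2 t c' →
        a + b + c = a' + b' + c' → a = a' ∧ b = b' ∧ c = c') : False := by
  have sub : ∀ {γ : Type} (i : Fin 3) (t : Fin k → (γ → R) → R) (a : (γ → R) → R),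
      (∀ i, DefFun L (t i)) → DefFun L a → DefRel L fun w => A i (fun j => t j w) (a w) := by
    intro γ i t a ht ha
    exact (hA i).subst (f := Sum.elim t fun _ => a) (by rintro (j | j); exacts [ht j, ha])
  -- Row `i` says that `x` is a sum whose `i`-th summand is the last parameter. Uniqueness of
  -- summands makes a row disjoint, and any three chosen summands are realized by their sum.
  refine false_of_finite_grids (L := L) (R := R) hT (β := Fin k ⊕ Fin 1)
    (fun i w => ∃ a b c, A 0 (fun j => w (Sum.inr (Sum.inl j))) a ∧
      A 1 (fun j => w (Sum.inr (Sum.inl j))) b ∧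
      A 2 (fun j => w (Sum.inr (Sum.inl j))) c ∧
      w (Sum.inl 0) = a + b + c ∧ w (Sum.inr (Sum.inr 0)) = ![a, b, c] i) ?_ ?_
  · intro i
    refine DefRel.ex (DefRel.ex (DefRel.ex (.and (sub _ _ _ (fun _ => .var _) (.var _))
      (.and (sub _ _ _ (fun _ => .var _) (.var _)) (.and (sub _ _ _ (fun _ => .var _) (.var _))
      (.and (.eq (.var _) (.add hexp (.add hexp (.var _) (.var _)) (.var _)))
        (.eq (.var _) ?_)))))))
    fin_cases i <;> exact .var _
  · intro N
    obtain ⟨t, h1, h2⟩ := h N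
    choose f hf hinj using fun i => exists_injOn_of_le_encard (h1 i)
    refine ⟨fun i j => Sum.elim t fun _ => f i j, ?_, ?_⟩
    · rintro i j hj j' hj' hne ⟨x, ⟨a, b, c, ha, hb, hc, hx, hi⟩, a', b', c', ha', hb', hc', hx', hi'⟩
      obtain ⟨rfl, rfl, rfl⟩ := h2 a b c a' b' c' ha hb hc ha' hb' hc' (hx.symm.trans hx')
      exact hne (hinj i j hj j' hj' (hi.trans hi'.symm))
    · intro η hη
      refine ⟨fun _ => f 0 (η 0) + f 1 (η 1) + f 2 (η 2), fun i =>
        ⟨_, _, _, hf 0 _ (hη 0), hf 1 _ (hη 1), hf 2 _ (hη 2), rfl, ?_⟩⟩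
      fin_cases i <;> rfl

end DirectSums

/-! ### Definable discrete sets do not accumulate -/

section DiscreteSets

variable {L : FirstOrder.Language.{u, v}} {R : Type m} [L.Structure R]
  [AddCommGroup R] [LinearOrder R]

/-- Every element of `Y` has distance at least `ε` from `y`, except `y` itself. -/
def IsSeparatedAt (Y : Set R) (ε y : R) : Prop :=
  ∀ e, e ∈ Y → (e < y → e + ε ≤ y) ∧ (y < e → y + ε ≤ e)

theorem IsSeparatedAt.defRel (hexp : ExpandsAddLT L R) {Y : Set R} (hY : IsDefinable L Y)
    {α : Type} [Finite α] {f g : (α → R) → R} (hf : DefFun L f) (hg : DefFun L g) :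
    DefRel L fun v => IsSeparatedAt Y (f v) (g v) := by
  have h2 : DefRel L fun v : Fin 2 → R => IsSeparatedAt Y (v 0) (v 1) := by
    unfold IsSeparatedAt
    apply_rules [DefRel.and, DefRel.imp, DefRel.all, DefRel.mem hY, DefRel.lt hexp, DefRel.le hexp,
      DefFun.add hexp, DefFun.var]
  exact h2.subst (f := ![f, g]) (by intro b; fin_cases b <;> assumption)

theorem exists_isGLB_of_isDefinablyComplete (hexp : ExpandsAddLT L R)
    (hdc : IsDefinablyComplete L R) {Y : Set R} (hY : IsDefinable L Y) (hne : Y.Nonempty)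
    (hb : BddBelow Y) : ∃ s, IsGLB Y s := by
  have hd : IsDefinable L (lowerBounds Y) := by
    apply DefRel.isDefinable
    change DefRel L fun v : Fin 1 → R => ∀ y, y ∈ Y → v 0 ≤ y
    apply_rules [DefRel.imp, DefRel.all, DefRel.mem hY, DefRel.le hexp, DefFun.var]
  obtain ⟨s, hs⟩ := hdc _ hd hb (hne.mono fun y hy z hz => hz hy)
  exact ⟨s, isLUB_lowerBounds.1 hs⟩

theorem isDefinable_neg (hexp : ExpandsAddLT L R) {Y : Set R} (hY : IsDefinable L Y) :
    IsDefinable L {z | -z ∈ Y} := by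
  have : DefRel L fun v : Fin 1 → R => 0 - v 0 ∈ Y := by
    apply_rules [DefRel.mem hY, DefFun.sub hexp, DefFun.var, DefFun.const]
  exact DefRel.isDefinable (this.congr fun v => by simp)

variable [IsOrderedAddMonoid R]

theorem IsSeparatedAt.mono {Y : Set R} {ε ε' y : R} (h : IsSeparatedAt Y ε y) (hε : ε' ≤ ε) :
    IsSeparatedAt Y ε' y := fun e he =>
  ⟨fun h1 => (add_le_add_right hε e).trans ((h e he).1 h1), fun h1 => (add_le_add_right hε y).trans ((h e he).2 h1)⟩

theorem exists_pos_isSeparatedAt_of_finite {Y : Set R} (hsep : ∀ y ∈ Y, ∃ ε, 0 < ε ∧ IsSeparatedAt Y ε y)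
    {ε : R} (hε : 0 < ε) {t : Set R} (ht : t.Finite) (htY : t ⊆ Y) :
    ∃ δ, 0 < δ ∧ δ ≤ ε ∧ ∀ y ∈ t, IsSeparatedAt Y δ y := by
  induction t, ht using Set.Finite.induction_on with
  | empty => exact ⟨ε, hε, le_rfl, by simp⟩
  | @insert a s _ _ ih =>
    obtain ⟨δ, h1, h2, h3⟩ := ih fun x hx => htY (Set.mem_insert_of_mem _ hx)
    obtain ⟨δ', h1', h3'⟩ := hsep a (htY (Set.mem_insert _ _))
    refine ⟨min δ δ', lt_min h1 h1', (min_le_left _ _).trans h2, ?_⟩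
    rintro y (rfl | hy)
    · exact h3'.mono (min_le_right _ _)
    · exact (h3 y hy).mono (min_le_left _ _)

theorem IsDivisible.exists_pos_add_add_lt (hdiv : IsDivisible R) {ε : R} (hε : 0 < ε) :
    ∃ δ, 0 < δ ∧ δ + δ + δ < ε := by
  obtain ⟨δ, hδ⟩ := hdiv 4 (by norm_num) ε
  have : 0 < δ := by
    by_contra h
    grind
  exact ⟨δ, this, by grind⟩

/-- A definable set of isolated positive elements does not accumulate at `0`. -/
theorem false_of_accumulates_at_zero (hexp : ExpandsAddLT L R) (hdiv : IsDivisible R)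
    (hT : ¬ HasInpPattern (L.completeTheory R) (Cardinal.mk (Fin 3)))
    {Y : Set R} (hY : IsDefinable L Y) (hpos : ∀ y ∈ Y, 0 < y)
    (hsep : ∀ y ∈ Y, ∃ ε, 0 < ε ∧ IsSeparatedAt Y ε y)
    (hne : Y.Nonempty) (hacc : ∀ ε, 0 < ε → ∃ y ∈ Y, y < ε) : False := by
  have key : ∀ (N : ℕ) (ε : R), 0 < ε → ∃ δ, 0 < δ ∧ δ ≤ ε ∧
      (N : ℕ∞) ≤ {y | y ∈ Y ∧ IsSeparatedAt Y δ y ∧ y + y + y < ε}.encard := by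
    intro N ε hε
    have hinf : {y | y ∈ Y ∧ y + y + y < ε}.Infinite := by
      intro hfin
      obtain ⟨δ, hδ, hδ'⟩ := hdiv.exists_pos_add_add_lt hε
      obtain ⟨y, hy, hyδ⟩ := hacc δ hδ
      obtain ⟨z, ⟨hz, hzε⟩, hzmin⟩ := Set.exists_min_image _ id hfin ⟨y, hy, by grind⟩
      obtain ⟨y', hy', hlt⟩ := hacc z (hpos z hz)
      exact absurd (hzmin y' ⟨hy', by grind⟩) (not_le.2 hlt)
    obtain ⟨t, hts, htN⟩ := Set.exists_subset_encard_eq (hinf.encard_eq ▸ le_top : (N : ℕ∞) ≤ _)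
    obtain ⟨δ, h1, h2, h3⟩ := exists_pos_isSeparatedAt_of_finite hsep hε
      (Set.finite_of_encard_eq_coe htN) fun y hy => (hts hy).1
    exact ⟨δ, h1, h2, htN.symm.le.trans (Set.encard_le_encard fun y hy =>
      ⟨(hts hy).1, h3 y hy, (hts hy).2⟩)⟩
  -- The parameters are scales `ε₁ ≥ ε₂`. The first summands are `ε₁`-separated, the second are
  -- `ε₂`-separated and below a third of `ε₁`, the third are below a third of `ε₂`.
  refine false_of_direct_sums (L := L) (R := R) hexp hT (k := 2)
    ![fun t y => y ∈ Y ∧ IsSeparatedAt Y (t 0) y,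
      fun t y => y ∈ Y ∧ IsSeparatedAt Y (t 1) y ∧ y + y + y < t 0,
      fun t y => y ∈ Y ∧ y + y + y < t 1] ?_ ?_
  · intro i
    fin_cases i <;>
    · simp only [Fin.zero_eta, Fin.mk_one, Fin.reduceFinMk, Matrix.cons_val]
      apply_rules [DefRel.and, DefRel.mem hY, DefRel.lt hexp, IsSeparatedAt.defRel hexp hY,
        DefFun.add hexp, DefFun.var]
  · intro N
    obtain ⟨y₀, hy₀⟩ := hne
    obtain ⟨ε₁, h1, h1', h1N⟩ := key N y₀ (hpos y₀ hy₀)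
    obtain ⟨ε₂, h2, h2', h2N⟩ := key N ε₁ h1
    obtain ⟨ε₃, h3, h3', h3N⟩ := key N ε₂ h2
    refine ⟨![ε₁, ε₂], fun i => ?_, ?_⟩
    · fin_cases i
      · exact h1N.trans (Set.encard_le_encard fun y hy => ⟨hy.1, hy.2.1⟩)
      · exact h2N
      · exact h3N.trans (Set.encard_le_encard fun y hy => ⟨hy.1, hy.2.2⟩)
    · rintro a b c a' b' c' ⟨ha, hsa⟩ ⟨hb, hsb, hbl⟩ ⟨hc, hcl⟩ ⟨ha', hsa'⟩ ⟨hb', hsb', hbl'⟩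
        ⟨hc', hcl'⟩ heq
      simp only [Matrix.cons_val] at hsa hsb hbl hcl hsa' hsb' hbl' hcl'
      have := hpos b hb
      have := hpos b' hb'
      have := hpos c hc
      have := hpos c' hc'
      -- Distinct `a`, `a'` are at least `ε₁` apart, but `b + c` and `b' + c'` lie strictly between
      -- `0` and `ε₁`. The same argument with `ε₂` then gives `b = b'`.
      have haa : a = a' := by
        have := hsa a' ha'
        rcases lt_trichotomy a a' with h | h | h <;> grind
      subst haa
      have hbb : b = b' := by
        have := hsb b' hb'
        rcases lt_trichotomy b b' with h | h | h <;> grind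
      subst hbb
      exact ⟨rfl, rfl, add_left_cancel heq⟩

/-- `D` is definable, and its bounded definable nonempty subsets have a least and a greatest
element. -/
structure IsLocallyPseudofinite (L : FirstOrder.Language.{u, v}) {R : Type m} [L.Structure R]
    [LinearOrder R] (D : Set R) : Prop where
  isDefinable : IsDefinable L D
  exists_isLeast : ∀ Y ⊆ D, IsDefinable L Y → Y.Nonempty → BddBelow Y → ∃ a, IsLeast Y a
  exists_isGreatest : ∀ Y ⊆ D, IsDefinable L Y → Y.Nonempty → BddAbove Y → ∃ a, IsGreatest Y a

/-- If the infimum `s` were not attained, the translate of `Y` by `-s` would consist of isolated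
positive points accumulating at `0`. -/
theorem exists_isLeast_of_isolated (hexp : ExpandsAddLT L R) (hdiv : IsDivisible R)
    (hdc : IsDefinablyComplete L R)
    (hT : ¬ HasInpPattern (L.completeTheory R) (Cardinal.mk (Fin 3)))
    {Y : Set R} (hY : IsDefinable L Y) (hsep : ∀ y ∈ Y, ∃ ε, 0 < ε ∧ IsSeparatedAt Y ε y)
    (hne : Y.Nonempty) (hb : BddBelow Y) : ∃ a, IsLeast Y a := by
  obtain ⟨s, hs⟩ := exists_isGLB_of_isDefinablyComplete hexp hdc hY hne hb
  by_cases hsY : s ∈ Y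
  · exact ⟨s, hsY, hs.1⟩
  refine (false_of_accumulates_at_zero (L := L) hexp hdiv hT (Y := {z | s + z ∈ Y}) ?_ ?_ ?_ ?_ ?_).elim
  · apply DefRel.isDefinable
    simp only [Set.mem_ofPred_eq]
    apply_rules [DefRel.mem hY, DefFun.add hexp, DefFun.var, DefFun.const]
  · intro z (hz : s + z ∈ Y)
    have h1 := hs.1 hz
    rcases h1.lt_or_eq with h | h
    · simpa using h
    · exact absurd (h ▸ hz) hsY
  · intro z (hz : s + z ∈ Y)
    obtain ⟨ε, hε, h⟩ := hsep _ hz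
    refine ⟨ε, hε, fun e he => ?_⟩
    have := h (s + e) he
    constructor <;> grind
  · obtain ⟨y, hy⟩ := hne
    exact ⟨y - s, by simpa using hy⟩
  · intro ε hε
    by_contra! hcon
    have : s + ε ≤ s := hs.2 fun y hy => by
      have := hcon (y - s) (by simpa using hy)
      grind
    grind

theorem exists_isSeparatedAt_of_isDiscrete [TopologicalSpace R] [OrderTopology R] [Nontrivial R]
    {D : Set R} (hD : IsDiscrete D) {d : R} (hd : d ∈ D) : ∃ ε, 0 < ε ∧ IsSeparatedAt D ε d := by
  obtain ⟨U, hU, hUD⟩ := (isDiscrete_iff_forall_mem_exists_isOpen.1 hD) d hd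
  have hmem : U ∈ nhds d := hU.mem_nhds (by have : d ∈ U ∩ D := hUD ▸ rfl; exact this.1)
  obtain ⟨ε, hε, hsub⟩ := (nhds_basis_abs_sub_lt d).mem_iff.1 hmem
  refine ⟨ε, hε, fun e he => ?_⟩
  have : |e - d| < ε → e = d := fun h => by
    have : e ∈ U ∩ D := ⟨hsub h, he⟩
    rwa [hUD] at this
  rw [abs_lt] at this
  constructor <;> intro _ <;> by_contra _ <;> grind

/-- Definable discrete sets are locally pseudofinite. -/
theorem isLocallyPseudofinite_of_isDiscrete [TopologicalSpace R] [OrderTopology R] [Nontrivial R]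
    (hexp : ExpandsAddLT L R) (hdiv : IsDivisible R) (hdc : IsDefinablyComplete L R)
    (hT : ¬ HasInpPattern (L.completeTheory R) (Cardinal.mk (Fin 3)))
    {D : Set R} (hD : IsDefinable L D) (hdisc : IsDiscrete D) : IsLocallyPseudofinite L D := by
  have hsub : ∀ Y ⊆ D, ∀ y ∈ Y, ∃ ε, 0 < ε ∧ IsSeparatedAt Y ε y := fun Y hYD y hy => by
    obtain ⟨ε, hε, h⟩ := exists_isSeparatedAt_of_isDiscrete hdisc (hYD hy)
    exact ⟨ε, hε, fun e he => h e (hYD he)⟩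
  refine ⟨hD, fun Y hYD hY hne hb => exists_isLeast_of_isolated hexp hdiv hdc hT hY (hsub Y hYD) hne hb,
    fun Y hYD hY ⟨y, hy⟩ ⟨b, hb⟩ => ?_⟩
  obtain ⟨a, ha, ha'⟩ := exists_isLeast_of_isolated hexp hdiv hdc hT (isDefinable_neg hexp hY) (fun z hz => by
    obtain ⟨ε, hε, h⟩ := hsub Y hYD _ hz
    refine ⟨ε, hε, fun e he => ?_⟩
    have := h (-e) he
    constructor <;> grind) ⟨-y, by simpa using hy⟩ ⟨-b, fun z hz => by
      have := hb (show -z ∈ Y from hz)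
      grind⟩
  refine ⟨-a, ha, fun z hz => ?_⟩
  have := ha' (show -z ∈ {z | -z ∈ Y} by simpa using hz)
  grind

end DiscreteSets

/-! ### Pseudofinite sets and their sums -/

section Pseudofinite

variable {L : FirstOrder.Language.{u, v}} {R : Type m} [L.Structure R]

/-- `X` is definable, and its nonempty definable subsets have a least and a greatest element. -/
structure IsPseudofinite (L : FirstOrder.Language.{u, v}) {R : Type m} [L.Structure R]
    [LinearOrder R] (X : Set R) : Prop where
  isDefinable : IsDefinable L X
  exists_isLeast : ∀ Y ⊆ X, IsDefinable L Y → Y.Nonempty → ∃ a, IsLeast Y a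
  exists_isGreatest : ∀ Y ⊆ X, IsDefinable L Y → Y.Nonempty → ∃ a, IsGreatest Y a

variable [AddCommGroup R] [LinearOrder R]

theorem IsLocallyPseudofinite.inter_Icc (hexp : ExpandsAddLT L R) {D : Set R}
    (hD : IsLocallyPseudofinite L D) (s s' : R) :
    IsPseudofinite L {x | x ∈ D ∧ s ≤ x ∧ x ≤ s'} where
  isDefinable := by
    apply DefRel.isDefinable
    simp only [Set.mem_ofPred_eq]
    apply_rules [DefRel.and, DefRel.mem hD.isDefinable, DefRel.le hexp, DefFun.var, DefFun.const]
  exists_isLeast Y hY hYd hne :=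
    hD.exists_isLeast Y (fun y hy => (hY hy).1) hYd hne ⟨s, fun _ hy => (hY hy).2.1⟩
  exists_isGreatest Y hY hYd hne :=
    hD.exists_isGreatest Y (fun y hy => (hY hy).1) hYd hne ⟨s', fun _ hy => (hY hy).2.2⟩

variable [IsOrderedAddMonoid R]

theorem IsPseudofinite.neg (hexp : ExpandsAddLT L R) {X : Set R} (hX : IsPseudofinite L X) :
    IsPseudofinite L {z | -z ∈ X} where
  isDefinable := isDefinable_neg hexp hX.isDefinable
  exists_isLeast Y hY hYd hne := by
    obtain ⟨a, ha, ha'⟩ := hX.exists_isGreatest {z | -z ∈ Y} (fun z hz => by simpa using hY hz)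
      (isDefinable_neg hexp hYd) (hne.imp' Neg.neg fun y hy => by simpa using hy)
    refine ⟨-a, ha, fun z hz => ?_⟩
    have := ha' (show -z ∈ {z | -z ∈ Y} by simpa using hz)
    grind
  exists_isGreatest Y hY hYd hne := by
    obtain ⟨a, ha, ha'⟩ := hX.exists_isLeast {z | -z ∈ Y} (fun z hz => by simpa using hY hz)
      (isDefinable_neg hexp hYd) (hne.imp' Neg.neg fun y hy => by simpa using hy)
    refine ⟨-a, ha, fun z hz => ?_⟩
    have := ha' (show -z ∈ {z | -z ∈ Y} by simpa using hz)
    grind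

/-- The finite-case proof, maximizing over `x` one value at a time, becomes a definable induction
along the first summands in `X`. -/
theorem IsPseudofinite.exists_isGreatest_of_subset_add (hexp : ExpandsAddLT L R) {X Y Z : Set R}
    (hX : IsPseudofinite L X) (hY : IsPseudofinite L Y) (hZ : IsDefinable L Z) (hne : Z.Nonempty)
    (hsub : ∀ z ∈ Z, ∃ x ∈ X, ∃ y ∈ Y, z = x + y) : ∃ a, IsGreatest Z a := by
  let T : Set R := {x | x ∈ X ∧ ∃ y, y ∈ Y ∧ x + y ∈ Z}
  -- The bound `z₀` may be any element of `Z`; it need not itself have a first summand at most `x`.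
  -- At the greatest element of `T` it bounds all of `Z`.
  let G : R → Prop := fun x => ∃ z₀, z₀ ∈ Z ∧ ∀ z, z ∈ Z → (∃ x', x' ∈ X ∧ x' ≤ x ∧ z - x' ∈ Y) → z ≤ z₀
  have hTd : IsDefinable L T := by
    apply DefRel.isDefinable
    simp only [T, Set.mem_ofPred_eq]
    apply_rules [DefRel.and, DefRel.ex, DefRel.mem hX.isDefinable, DefRel.mem hY.isDefinable,
      DefRel.mem hZ, DefFun.add hexp, DefFun.var]
  have hlt : ∀ x, IsDefinable L {x' | x' ∈ T ∧ x' < x} := fun x =>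
    DefRel.isDefinable (.and (.mem hTd (.var 0)) (.lt hexp (.var 0) (.const x)))
  -- At a least counterexample `x₀`, a bound is the larger of the bound at its predecessor in `T`
  -- (if any) and `x₀ + y₀`, with `y₀` the greatest `y` in `Y` such that `x₀ + y ∈ Z`.
  have hG : ∀ x ∈ T, G x := by
    by_contra! hcon
    obtain ⟨x, hx, hGx⟩ := hcon
    obtain ⟨x₀, ⟨hx₀, hGx₀⟩, hmin⟩ := hX.exists_isLeast {x | x ∈ T ∧ ¬ G x} (fun x hx => hx.1.1) (by
      apply DefRel.isDefinable
      simp only [G, Set.mem_ofPred_eq]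
      apply_rules [DefRel.mem hX.isDefinable, DefRel.mem hY.isDefinable, DefRel.mem hTd,
        DefRel.mem hZ, DefRel.and, DefRel.ex, DefRel.all, DefRel.not, DefRel.imp, DefFun.add hexp, DefFun.sub hexp, DefRel.le hexp, DefFun.var]) ⟨x, hx, hGx⟩
    obtain ⟨hx₀X, y, hy, hyZ⟩ := hx₀
    obtain ⟨y₀, ⟨hy₀, hy₀Z⟩, hmax⟩ := hY.exists_isGreatest {y | y ∈ Y ∧ x₀ + y ∈ Z}
      (fun y hy => hy.1) (by
        apply DefRel.isDefinable
        simp only [Set.mem_ofPred_eq]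
        apply_rules [DefRel.and, DefRel.mem hY.isDefinable,
          DefRel.mem hZ, DefFun.add hexp, DefFun.var, DefFun.const]) ⟨y, hy, hyZ⟩
    have hlast : ∀ z ∈ Z, z - x₀ ∈ Y → z ≤ x₀ + y₀ := fun z hz hzY => by
      have := hmax ⟨hzY, by simpa using hz⟩
      grind
    by_cases hlow : {x' | x' ∈ T ∧ x' < x₀}.Nonempty
    · obtain ⟨x₁, ⟨hx₁, hx₁x₀⟩, hx₁max⟩ := hX.exists_isGreatest _ (fun x hx => hx.1.1) (hlt x₀) hlow
      have hG₁ : G x₁ := by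
        by_contra h
        exact absurd (hmin ⟨hx₁, h⟩) (not_le.2 hx₁x₀)
      obtain ⟨z₁, hz₁, hz₁max⟩ := hG₁
      refine hGx₀ ⟨max z₁ (x₀ + y₀), ?_, ?_⟩
      · rcases max_choice z₁ (x₀ + y₀) with h | h <;> rwa [h]
      · rintro z hz ⟨x', hx', hle, hzx'⟩
        rcases hle.lt_or_eq with h | rfl
        · exact (hz₁max z hz ⟨x', hx', hx₁max ⟨⟨hx', _, hzx', by simpa using hz⟩, h⟩, hzx'⟩).trans
            (le_max_left _ _)
        · exact (hlast z hz hzx').trans (le_max_right _ _)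
    · refine hGx₀ ⟨x₀ + y₀, hy₀Z, ?_⟩
      rintro z hz ⟨x', hx', hle, hzx'⟩
      rcases hle.lt_or_eq with h | rfl
      · exact (hlow ⟨x', ⟨hx', _, hzx', by simpa using hz⟩, h⟩).elim
      · exact hlast z hz hzx'
  obtain ⟨z, hz⟩ := hne
  have hmem : ∀ z ∈ Z, ∃ x ∈ T, z - x ∈ Y := fun z hz => by
    obtain ⟨x, hx, y, hy, rfl⟩ := hsub z hz
    exact ⟨x, ⟨hx, y, hy, hz⟩, by simpa using hy⟩
  obtain ⟨x, hx, -⟩ := hmem z hz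
  obtain ⟨x₀, hx₀, hmax⟩ := hX.exists_isGreatest T (fun x hx => hx.1) hTd ⟨x, hx⟩
  obtain ⟨z₀, hz₀, hz₀max⟩ := hG x₀ hx₀
  refine ⟨z₀, hz₀, fun z hz => ?_⟩
  obtain ⟨x', hx', hzx'⟩ := hmem z hz
  exact hz₀max z hz ⟨x', hx'.1, hmax hx', hzx'⟩

theorem IsPseudofinite.add (hexp : ExpandsAddLT L R) {X Y : Set R} (hX : IsPseudofinite L X)
    (hY : IsPseudofinite L Y) : IsPseudofinite L {z | ∃ x, x ∈ X ∧ ∃ y, y ∈ Y ∧ z = x + y} where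
  isDefinable := by
    apply DefRel.isDefinable
    simp only [Set.mem_ofPred_eq]
    apply_rules [DefRel.and, DefRel.ex, DefRel.eq, DefRel.mem hX.isDefinable,
      DefRel.mem hY.isDefinable, DefFun.add hexp, DefFun.var]
  exists_isGreatest Z hZ hZd hne := hX.exists_isGreatest_of_subset_add hexp hY hZd hne hZ
  exists_isLeast Z hZ hZd hne := by
    obtain ⟨a, ha, ha'⟩ := (hX.neg hexp).exists_isGreatest_of_subset_add hexp (hY.neg hexp)
      (isDefinable_neg hexp hZd) (hne.imp' Neg.neg fun y hy => by simpa using hy) fun z hz => by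
        obtain ⟨x, hx, y, hy, h⟩ := hZ hz
        exact ⟨-x, by simpa using hx, -y, by simpa using hy, by grind⟩
    refine ⟨-a, ha, fun z hz => ?_⟩
    have := ha' (show -z ∈ {z | -z ∈ Z} by simpa using hz)
    grind

theorem IsPseudofinite.exists_pos_le (hexp : ExpandsAddLT L R) [Nontrivial R] {X : Set R}
    (hX : IsPseudofinite L X) : ∃ δ : R, 0 < δ ∧ ∀ x ∈ X, 0 < x → δ ≤ x := by
  by_cases hne : {x | x ∈ X ∧ 0 < x}.Nonempty
  · obtain ⟨δ, hδ, hmin⟩ := hX.exists_isLeast {x | x ∈ X ∧ 0 < x} (fun x hx => hx.1) (by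
      apply DefRel.isDefinable
      simp only [Set.mem_ofPred_eq]
      apply_rules [DefRel.and, DefRel.mem hX.isDefinable, DefRel.lt hexp, DefFun.var,
        DefFun.const]) hne
    exact ⟨δ, hδ.2, fun x hx hx0 => hmin ⟨hx, hx0⟩⟩
  · obtain ⟨δ, hδ⟩ := exists_gt (0 : R)
    exact ⟨δ, hδ, fun x hx hx0 => (hne ⟨x, hx, hx0⟩).elim⟩

end Pseudofinite

/-! ### Long gaps in window classes versus short differences -/

section WindowClasses

variable {L : FirstOrder.Language.{u, v}} {R : Type m} [L.Structure R]
  [AddCommGroup R] [LinearOrder R]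

/-- `D` looks the same on `[d, d + t]` as on `[c, c + t]`. -/
def AgreeUpTo (D : Set R) (t d c : R) : Prop :=
  ∀ x, 0 ≤ x → x ≤ t → (d + x ∈ D ↔ c + x ∈ D)

/-- The elements of `D` at which `D` agrees with `D` at `c` up to `t`. -/
def windowClass (D : Set R) (t c : R) : Set R := {d | d ∈ D ∧ AgreeUpTo D t d c}

/-- The elements of `E` whose successor in `E` is at distance at least `h`. -/
def longGaps (E : Set R) (h : R) : Set R := {b | b ∈ E ∧ ∃ b', IsSucc E b b' ∧ b + h ≤ b'}

/-- The nonnegative differences less than `h` of elements of `D`. -/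
def shortDiffs (D : Set R) (h : R) : Set R :=
  {z | ∃ d e, d ∈ D ∧ e ∈ D ∧ z = e - d ∧ 0 ≤ z ∧ z < h}

theorem isSucc_iff {R : Type*} [LinearOrder R] {E : Set R} {a b : R} :
    IsSucc E a b ↔ (b ∈ E ∧ a < b) ∧ ∀ c, c ∈ E → a < c → b ≤ c :=
  ⟨fun h => ⟨h.1, fun _ h1 h2 => h.2 ⟨h1, h2⟩⟩, fun h => ⟨h.1, fun _ hc => h.2 _ hc.1 hc.2⟩⟩

variable {α : Type}

theorem AgreeUpTo.defRel (hexp : ExpandsAddLT L R) {D : Set R} (hD : IsDefinable L D)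
    {f g k : (α → R) → R} (hf : DefFun L f) (hg : DefFun L g) (hk : DefFun L k) :
    DefRel L fun v => AgreeUpTo D (f v) (g v) (k v) := by
  have h3 : DefRel L fun v : Fin 3 → R => AgreeUpTo D (v 0) (v 1) (v 2) := by
    unfold AgreeUpTo
    apply_rules [DefRel.imp, DefRel.all, DefRel.iff, DefRel.mem hD, DefRel.le hexp,
      DefFun.add hexp, DefFun.var, DefFun.const]
  exact h3.subst (f := ![f, g, k]) (by intro b; fin_cases b <;> assumption)

theorem mem_windowClass_defRel [Finite α] (hexp : ExpandsAddLT L R) {D : Set R} (hD : IsDefinable L D)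
    {f g k : (α → R) → R} (hf : DefFun L f) (hg : DefFun L g) (hk : DefFun L k) :
    DefRel L fun v => k v ∈ windowClass D (f v) (g v) :=
  (DefRel.mem hD hk).and (AgreeUpTo.defRel hexp hD hf hk hg)

theorem mem_longGaps_windowClass_defRel (hexp : ExpandsAddLT L R) {D : Set R} (hD : IsDefinable L D)
    {f g k l : (α → R) → R} (hf : DefFun L f) (hg : DefFun L g) (hk : DefFun L k)
    (hl : DefFun L l) :
    DefRel L fun v => l v ∈ longGaps (windowClass D (f v) (g v)) (k v) := by
  have h4 : DefRel L fun v : Fin 4 → R => v 3 ∈ longGaps (windowClass D (v 0) (v 1)) (v 2) := by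
    simp only [longGaps, isSucc_iff, Set.mem_ofPred_eq]
    apply_rules [mem_windowClass_defRel hexp hD, DefRel.and, DefRel.imp, DefRel.all, DefRel.ex,
      DefRel.le hexp, DefRel.lt hexp, DefFun.add hexp, DefFun.var]
  exact h4.subst (f := ![f, g, k, l]) (by intro b; fin_cases b <;> assumption)

theorem exists_finite_of_finite_subset_shortDiffs {D O : Set R} {h : R} (hO : O.Finite)
    (hsub : O ⊆ shortDiffs D h) : ∃ W : Set R, W.Finite ∧
      ∀ z ∈ O, ∃ d e, (d ∈ D ∧ d ∈ W) ∧ (e ∈ D ∧ e ∈ W) ∧ z = e - d ∧ 0 ≤ z ∧ z < h := by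
  have hsub' : ∀ z ∈ O, ∃ d e, d ∈ D ∧ e ∈ D ∧ z = e - d ∧ 0 ≤ z ∧ z < h := fun z hz => hsub hz
  choose! d e hd he hz using hsub'
  exact ⟨d '' O ∪ e '' O, (hO.image d).union (hO.image e), fun z hzO =>
    ⟨d z, e z, ⟨hd z hzO, Or.inl ⟨z, hzO, rfl⟩⟩, ⟨he z hzO, Or.inr ⟨z, hzO, rfl⟩⟩, hz z hzO⟩⟩

variable [IsOrderedAddMonoid R]

/-- Either there are few long gaps in the classes of `D`, or there are few short differences. -/
theorem IsLocallyPseudofinite.exists_encard_lt (hexp : ExpandsAddLT L R) [Nontrivial R]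
    [DenselyOrdered R]
    (hT : ¬ HasInpPattern (L.completeTheory R) (Cardinal.mk (Fin 3))) {D : Set R}
    (hD : IsLocallyPseudofinite L D) :
    ∃ N : ℕ, ∀ t c h, (longGaps (windowClass D t c) h).encard < N ∨ (shortDiffs D h).encard < N := by
  by_contra! hcon
  have hDd := hD.isDefinable
  refine false_of_direct_sums (L := L) (R := R) hexp hT (k := 6)
    ![fun p x => x ∈ longGaps (windowClass D (p 0) (p 1)) (p 2) ∧ p 3 ≤ x ∧ x ≤ p 4,
      fun p x => ∃ d e, (d ∈ D ∧ p 3 ≤ d ∧ d ≤ p 4) ∧ (e ∈ D ∧ p 3 ≤ e ∧ e ≤ p 4) ∧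
        x = e - d ∧ 0 ≤ x ∧ x < p 2,
      fun p x => 0 < x ∧ x < p 5] ?_ ?_
  · intro i
    fin_cases i <;>
    · simp only [Fin.zero_eta, Fin.mk_one, Fin.reduceFinMk, Matrix.cons_val]
      apply_rules [mem_longGaps_windowClass_defRel hexp hDd, DefRel.and, DefRel.ex, DefRel.eq,
        DefRel.mem hDd, DefRel.lt hexp, DefRel.le hexp, DefFun.sub hexp, DefFun.var, DefFun.const]
  · intro N
    obtain ⟨t, c, h, hA, hO⟩ := hcon N
    obtain ⟨A, hAs, hAN⟩ := Set.exists_subset_encard_eq hA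
    obtain ⟨O, hOs, hON⟩ := Set.exists_subset_encard_eq hO
    have hAf := Set.finite_of_encard_eq_coe hAN
    obtain ⟨W, hWf, hW⟩ := exists_finite_of_finite_subset_shortDiffs
      (Set.finite_of_encard_eq_coe hON) hOs
    obtain ⟨s, hs⟩ := (hAf.union hWf).bddBelow
    obtain ⟨s', hs'⟩ := (hAf.union hWf).bddAbove
    have hX := hD.inter_Icc hexp s s'
    have hU := (hX.add hexp hX).add hexp (hX.neg hexp)
    -- With `X = D ∩ [s, s']`, all sums `a + (e - d)` lie in the pseudofinite set `X + X - X`, so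
    -- distinct ones differ by at least `δ`. This makes `(0, δ)` a free third summand, infinite by
    -- density.
    obtain ⟨δ, hδ, hδmin⟩ := (hU.add hexp (hU.neg hexp)).exists_pos_le hexp
    refine ⟨![t, c, h, s, s', δ], fun i => ?_, ?_⟩
    · fin_cases i
      · exact hAN.symm.le.trans (Set.encard_le_encard fun x hx =>
          ⟨hAs hx, hs (Or.inl hx), hs' (Or.inl hx)⟩)
      · refine hON.symm.le.trans (Set.encard_le_encard fun x hx => ?_)
        obtain ⟨d, e, ⟨hd, hdW⟩, ⟨he, heW⟩, h⟩ := hW x hx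
        exact ⟨d, e, ⟨hd, hs (Or.inr hdW), hs' (Or.inr hdW)⟩,
          ⟨he, hs (Or.inr heW), hs' (Or.inr heW)⟩, h⟩
      · exact ((Set.Ioo_infinite hδ).encard_eq ▸ le_top : (N : ℕ∞) ≤ (Set.Ioo 0 δ).encard)
    · simp only [Matrix.cons_val]
      rintro a b c₁ a' b' c₁' ⟨⟨ha, a₁, ha₁, haa₁⟩, has⟩ ⟨d, e, hd, he, rfl, hb, hb'⟩ ⟨hc, hcl⟩
        ⟨⟨ha', a₁', ha₁', haa₁'⟩, has'⟩ ⟨d', e', hd', he', rfl, hb₂, hb₂'⟩ ⟨hc', hcl'⟩ heq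
      have hmem : ∀ {a b d : R}, (a ∈ D ∧ s ≤ a ∧ a ≤ s') → (b ∈ D ∧ s ≤ b ∧ b ≤ s') →
          (d ∈ D ∧ s ≤ d ∧ d ≤ s') → (a + b + -d) ∈ {z | ∃ x, x ∈
            {z | ∃ x, x ∈ {x | x ∈ D ∧ s ≤ x ∧ x ≤ s'} ∧ ∃ y, y ∈ {x | x ∈ D ∧ s ≤ x ∧ x ≤ s'} ∧ z = x + y} ∧
            ∃ y, y ∈ {z | -z ∈ {x | x ∈ D ∧ s ≤ x ∧ x ≤ s'}} ∧ z = x + y} :=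
        fun ha hb hd => ⟨_, ⟨_, ha, _, hb, rfl⟩, _, by rwa [Set.mem_ofPred_eq, neg_neg], rfl⟩
      have h1 := hmem ⟨ha.1, has⟩ he hd
      have h2 := hmem ⟨ha'.1, has'⟩ he' hd'
      have h3 := hδmin _ ⟨_, h1, -(a' + e' + -d'), by simpa using h2, rfl⟩
      have h4 := hδmin _ ⟨_, h2, -(a + e + -d), by simpa using h1, rfl⟩
      have hcc : c₁ = c₁' := by
        rcases lt_trichotomy c₁ c₁' with h | h | h
        · have := h3 (by grind)
          grind
        · exact h
        · have := h4 (by grind)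
          grind
      -- If `a < a'`, then `a'` is at or beyond the successor of `a` in its class, hence at least `a
      -- + h`, whereas the second summands lie in `[0, h)`.
      have haa : a = a' := by
        rcases lt_trichotomy a a' with h | h | h
        · have := ha₁.2 ⟨ha', h⟩
          grind
        · exact h
        · have := ha₁'.2 ⟨ha, h⟩
          grind
      exact ⟨haa, by grind, hcc⟩

end WindowClasses

/-! ### Finitely many gaps, and the choice of a scale -/

section Gaps

variable {L : FirstOrder.Language.{u, v}} {R : Type m} [L.Structure R]
  [AddCommGroup R] [LinearOrder R]

theorem le_encard_of_injective {X : Type*} {N : ℕ} {s : Set X} (f : Fin N → X)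
    (hf : Function.Injective f) (hs : ∀ i, f i ∈ s) : (N : ℕ∞) ≤ s.encard := by
  have := hf.encard_range
  rw [ENat.card_eq_coe_fintype_card, Fintype.card_fin] at this
  exact this.trans (Set.encard_le_encard (Set.range_subset_iff.2 hs))

theorem windowClass_zero {D : Set R} {c : R} (hc : c ∈ D) : windowClass D 0 c = D := by
  ext d
  refine ⟨fun h => h.1, fun h => ⟨h, fun x h1 h2 => ?_⟩⟩
  obtain rfl := le_antisymm h2 h1
  simp [h, hc]

theorem IsLocallyPseudofinite.exists_isSucc (hexp : ExpandsAddLT L R) {D E : Set R}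
    (hD : IsLocallyPseudofinite L D) (hED : E ⊆ D) (hE : IsDefinable L E) {a b : R} (hb : b ∈ E)
    (hab : a < b) : ∃ c, IsSucc E a c ∧ c ≤ b := by
  obtain ⟨c, hc⟩ := hD.exists_isLeast {x | x ∈ E ∧ a < x} (fun x hx => hED hx.1)
    (DefRel.isDefinable (.and (.mem hE (.var 0)) (.lt hexp (.const a) (.var 0)))) ⟨b, hb, hab⟩
    ⟨a, fun x hx => hx.2.le⟩
  exact ⟨c, hc, hc.2 ⟨hb, hab⟩⟩

theorem IsSucc.unique {R : Type*} [LinearOrder R] {E : Set R} {a b b' : R} (h : IsSucc E a b) (h' : IsSucc E a b') : b = b' :=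
  IsLeast.unique h h'

variable [IsOrderedAddMonoid R]

/-- Given `N + N` gap sizes in increasing order, let `g` be the least of the upper half. The upper
half yields `N` gaps of length at least `g`, the lower half `N` differences below `g`, contradicting
the dichotomy at `g`. -/
theorem finite_diffSet {D : Set R} {N : ℕ}
    (hN : ∀ h, (longGaps D h).encard < N ∨ (shortDiffs D h).encard < N) : (diffSet D).Finite := by
  by_contra hinf
  obtain ⟨s, hs, hcard⟩ := Set.Infinite.exists_subset_card_eq hinf (N + N)
  have hN0 : 0 < N := by
    by_contra h
    obtain rfl : N = 0 := by omega
    simpa using hN 0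
  let f : Fin (N + N) ↪o R := s.orderEmbOfFin hcard
  have hf : ∀ i, f i ∈ diffSet D := fun i => hs (s.orderEmbOfFin_mem hcard i)
  choose a ha b hb hab using hf
  have hpos : ∀ i, 0 < f i := fun i => by
    have : a i < b i := (hb i).1.2
    rw [hab]
    exact sub_pos.2 this
  let g := f (Fin.natAdd N ⟨0, hN0⟩)
  rcases hN g with h | h
  · refine absurd (le_encard_of_injective (fun i : Fin N => a (Fin.natAdd N i)) ?_ ?_) (not_le.2 h)
    · intro i j hij
      have hij : a (Fin.natAdd N i) = a (Fin.natAdd N j) := hij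
      have h1 : b (Fin.natAdd N i) = b (Fin.natAdd N j) := (hb _).unique (hij ▸ hb _)
      have h2 : f (Fin.natAdd N i) = f (Fin.natAdd N j) := by rw [hab, hab, hij, h1]
      exact Fin.natAdd_injective _ _ (f.injective h2)
    · intro i
      refine ⟨ha _, b _, hb _, ?_⟩
      have h1 : g ≤ f (Fin.natAdd N i) := f.monotone (by simp [Fin.le_def])
      rw [hab] at h1
      grind
  · refine absurd (le_encard_of_injective (fun i : Fin N => f (Fin.castAdd N i)) ?_ ?_) (not_le.2 h)
    · exact f.injective.comp (Fin.castAdd_injective _ _)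
    · intro i
      refine ⟨a _, b _, ha _, (hb _).1.1, hab _, (hpos _).le, f.strictMono ?_⟩
      simp [Fin.lt_def]

/-- With finitely many gap sizes and infinitely many points, some size occurs infinitely often; `μ`
is the largest such size. -/
theorem exists_largest_infinite_gap (hexp : ExpandsAddLT L R) {D : Set R}
    (hD : IsLocallyPseudofinite L D) (hinf : D.Infinite) (hfin : (diffSet D).Finite) :
    ∃ μ, 0 < μ ∧ (longGaps D μ).Infinite ∧
      {b | b ∈ D ∧ ∃ b', IsSucc D b b' ∧ b + μ < b'}.Finite := by
  let fib : R → Set R := fun g => {b | b ∈ D ∧ IsSucc D b (b + g)}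
  have hcov : ∀ b b', b ∈ D → IsSucc D b b' → b' - b ∈ diffSet D ∧ b ∈ fib (b' - b) :=
    fun b b' hb h => ⟨⟨b, hb, b', h, rfl⟩, hb, by simpa using h⟩
  have hne : {g | g ∈ diffSet D ∧ (fib g).Infinite}.Nonempty := by
    by_contra hemp
    refine hinf (((Set.Subsingleton.finite (s := {b | IsGreatest D b})
      fun x hx y hy => IsGreatest.unique hx hy).union
      (hfin.biUnion (t := fib) fun g hg => ?_)).subset fun b hb => ?_)
    · by_contra h
      exact hemp ⟨g, hg, h⟩
    · by_cases hmax : IsGreatest D b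
      · exact Or.inl hmax
      · have : ∃ e ∈ D, b < e := by
          by_contra! h
          exact hmax ⟨hb, h⟩
        obtain ⟨e, he, hbe⟩ := this
        obtain ⟨b', hb', -⟩ := hD.exists_isSucc hexp subset_rfl hD.isDefinable he hbe
        exact Or.inr (Set.mem_biUnion (hcov b b' hb hb').1 (hcov b b' hb hb').2)
  obtain ⟨μ, ⟨hμ, hμinf⟩, hmax⟩ := Set.exists_max_image _ id (hfin.subset fun g hg => hg.1) hne
  refine ⟨μ, ?_, hμinf.mono ?_, ?_⟩
  · obtain ⟨a, -, b, hab, rfl⟩ := hμ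
    exact sub_pos.2 hab.1.2
  · rintro b ⟨hb, h⟩
    exact ⟨hb, _, h, le_rfl⟩
  · refine (((Set.Finite.subset hfin (t := {g | g ∈ diffSet D ∧ μ < g}) fun g hg => hg.1).biUnion (t := fib) ?_)).subset ?_
    · intro g hg
      by_contra h
      exact absurd (hmax g ⟨hg.1, h⟩) (not_le.2 hg.2)
    · rintro b ⟨hb, b', hbb', hlt⟩
      refine Set.mem_biUnion (x := b' - b) ⟨(hcov b b' hb hbb').1, ?_⟩ (hcov b b' hb hbb').2
      grind

/-- To go from `d` to `e`, walk to the last point `d'` before `d + μ`, then jump to its successor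
`b`. So `e - d` is a difference below `μ`, plus a gap, plus a difference below `n • μ`, each from a
finite set. -/
theorem finite_shortDiffs_nsmul (hexp : ExpandsAddLT L R) {D : Set R}
    (hD : IsLocallyPseudofinite L D) (hfin : (diffSet D).Finite) {μ : R} (hμ0 : 0 < μ)
    (hμ : (shortDiffs D μ).Finite) (n : ℕ) : (shortDiffs D (n • μ)).Finite := by
  induction n with
  | zero =>
    refine Set.finite_empty.subset ?_
    rintro z ⟨d, e, -, -, -, h1, h2⟩
    rw [zero_smul] at h2
    exact absurd h1 (not_le.2 h2)
  | succ n ih =>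
    refine (hμ.union (((hμ.prod (hfin.prod ih)).image fun p => p.1 + (p.2.1 + p.2.2)))).subset ?_
    rintro z ⟨d, e, hd, he, rfl, h1, h2⟩
    rw [succ_nsmul] at h2
    obtain ⟨d', ⟨hd', hd'μ⟩, hmax⟩ := hD.exists_isGreatest {x | x ∈ D ∧ x < d + μ} (fun x hx => hx.1)
      (DefRel.isDefinable (.and (.mem hD.isDefinable (.var 0)) (.lt hexp (.var 0) (.const _))))
      ⟨d, hd, by grind⟩ ⟨d + μ, fun x hx => hx.2.le⟩
    by_cases hed : e < d + μ
    · exact Or.inl ⟨d, e, hd, he, rfl, h1, by grind⟩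
    · have hd'e : d' < e := by grind
      have hdd' : d ≤ d' := hmax ⟨hd, by grind⟩
      obtain ⟨b, hb, hbe⟩ := hD.exists_isSucc hexp subset_rfl hD.isDefinable he hd'e
      have hbμ : d + μ ≤ b := by
        by_contra h
        exact absurd (hmax ⟨hb.1.1, not_le.1 h⟩) (not_le.2 hb.1.2)
      refine Or.inr ⟨(d' - d, b - d', e - b), ⟨⟨d, d', hd, hd', rfl, by grind, by grind⟩,
        ⟨d', hd', b, hb, rfl⟩, ⟨b, e, hb.1.1, he, rfl, by grind, ?_⟩⟩, by grind⟩
      have : e - d < n • μ + μ := h2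
      grind

/-- Successors advance by at most `μ`, so the first `n + 1` points from `d` on stay within `n • μ`
of it. -/
theorem le_encard_inter_Icc_nsmul (hexp : ExpandsAddLT L R) {D : Set R}
    (hD : IsLocallyPseudofinite L D) {μ : R} (hμ0 : 0 < μ) {e : R} (he : e ∈ D) (n : ℕ) :
    ∀ d ∈ D, (∀ b ∈ D, d ≤ b → b < e → ∀ b', IsSucc D b b' → b' ≤ b + μ) →
      (n + 1 : ℕ∞) ≤ (D ∩ Set.Icc d e).encard →
      (n + 1 : ℕ∞) ≤ (D ∩ Set.Icc d (d + n • μ)).encard := by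
  induction n with
  | zero =>
    intro d hd _ _
    have : (D ∩ Set.Icc d (d + 0 • μ)).Nonempty := ⟨d, hd, by simp⟩
    simpa using Set.one_le_encard_iff_nonempty.2 this
  | succ n ih =>
    intro d hd hb hcard
    have hde : d < e := by
      by_contra h
      have hsub : (D ∩ Set.Icc d e) ⊆ {d} := fun x hx => by
        have := hx.2.1
        have := hx.2.2
        exact le_antisymm (by order) (by order)
      have := hcard.trans ((Set.encard_le_encard hsub).trans (Set.encard_singleton d).le)
      have h2 : n + 1 + 1 ≤ 1 := by exact_mod_cast this
      omega
    obtain ⟨b, hbs, hbe⟩ := hD.exists_isSucc hexp subset_rfl hD.isDefinable he hde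
    have hdb : d < b := hbs.1.2
    have h1 := ih b hbs.1.1 (fun x hx hbx hxe => hb x hx (by order) hxe) (by
      have hsub : D ∩ Set.Icc d e ⊆ insert d (D ∩ Set.Icc b e) := by
        rintro x ⟨hx, hdx, hxe⟩
        rcases hdx.lt_or_eq with h | rfl
        · exact Or.inr ⟨hx, hbs.2 ⟨hx, h⟩, hxe⟩
        · exact Or.inl rfl
      have := hcard.trans ((Set.encard_le_encard hsub).trans (Set.encard_insert_le _ _))
      push_cast at this
      exact (ENat.add_le_add_iff_right ENat.one_ne_top).1 this)
    have hbμ := hb d hd le_rfl hde b hbs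
    have hsub : insert d (D ∩ Set.Icc b (b + n • μ)) ⊆ D ∩ Set.Icc d (d + (n + 1) • μ) := by
      have hnμ : 0 ≤ n • μ := nsmul_nonneg hμ0.le n
      rw [succ_nsmul]
      rintro x (rfl | ⟨hx, hbx, hxb⟩)
      · exact ⟨hd, le_rfl, by grind⟩
      · exact ⟨hx, by order, by grind⟩
    refine le_trans ?_ (Set.encard_le_encard hsub)
    rw [Set.encard_insert_of_notMem fun h => absurd h.2.1 (not_le.2 hdb)]
    push_cast
    gcongr

/-- For a finite set `B`, an infinite set `D` has arbitrarily large finite subsets which are not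
separated by `B`. -/
theorem exists_le_encard_inter_Icc {R : Type*} [LinearOrder R] {D B : Set R} (hD : D.Infinite) (hB : B.Finite) (n : ℕ) :
    ∃ d ∈ D, ∃ e ∈ D, (∀ b ∈ B, d ≤ b → ¬ b < e) ∧ (n + 1 : ℕ∞) ≤ (D ∩ Set.Icc d e).encard := by
  -- Points of `D` make only finitely many cuts in `B`, so infinitely many of them make the same
  -- cut.
  have : ∃ x ∈ (fun x => {b | b ∈ B ∧ b < x}) '' D, (D ∩ (fun x => {b | b ∈ B ∧ b < x}) ⁻¹' {x}).Infinite := by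
    by_contra! h
    refine hD (Set.Finite.of_finite_fibers (fun x => {b | b ∈ B ∧ b < x}) (hB.finite_subsets.subset ?_) fun x hx => ?_)
    · rintro _ ⟨x, -, rfl⟩ b hb
      exact hb.1
    · simpa using h x hx
  obtain ⟨C, -, hC⟩ := this
  obtain ⟨s, hs, hcard⟩ := hC.exists_subset_card_eq (n + 1)
  have hne : s.Nonempty := Finset.card_pos.1 (by omega)
  refine ⟨s.min' hne, (hs (s.min'_mem hne)).1, s.max' hne, (hs (s.max'_mem hne)).1, ?_, ?_⟩
  · intro b hb h1 h2
    have e1 : {b | b ∈ B ∧ b < s.min' hne} = C := (hs (s.min'_mem hne)).2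
    have e2 : {b | b ∈ B ∧ b < s.max' hne} = C := (hs (s.max'_mem hne)).2
    have : b ∈ {b | b ∈ B ∧ b < s.min' hne} := by
      rw [e1, ← e2]
      exact ⟨hb, h2⟩
    exact absurd h1 (not_le.2 this.2)
  · have : (s : Set R).encard = n + 1 := by
      rw [Set.encard_coe_eq_coe_finsetCard, hcard]
      push_cast
      rfl
    rw [← this]
    exact Set.encard_le_encard fun x hx => ⟨(hs hx).1, s.min'_le x hx, s.le_max' x hx⟩

/-- There is a scale `K` at which all classes of `D` have only finitely many long gaps, and
`D` has only finitely many short differences. -/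
theorem IsLocallyPseudofinite.exists_scale (hexp : ExpandsAddLT L R) [Nontrivial R]
    [DenselyOrdered R]
    (hT : ¬ HasInpPattern (L.completeTheory R) (Cardinal.mk (Fin 3))) {D : Set R}
    (hD : IsLocallyPseudofinite L D) (hinf : D.Infinite) :
    ∃ K : R, 0 < K ∧ (∀ t c, (longGaps (windowClass D t c) K).Finite) ∧
      (shortDiffs D (K + K + K)).Finite := by
  obtain ⟨N, hN⟩ := hD.exists_encard_lt hexp hT
  obtain ⟨c₀, hc₀⟩ := hinf.nonempty
  have hN0 : ∀ h, (longGaps D h).encard < N ∨ (shortDiffs D h).encard < N := fun h => by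
    simpa only [windowClass_zero hc₀] using hN 0 c₀ h
  have hfin := finite_diffSet hN0
  obtain ⟨μ, hμ0, hμinf, hB⟩ := exists_largest_infinite_gap hexp hD hinf hfin
  have hμfin : (shortDiffs D μ).Finite := by
    rcases hN0 μ with h | h
    · rw [hμinf.encard_eq] at h
      exact absurd h not_top_lt
    · exact Set.encard_lt_top_iff.1 (h.trans (ENat.natCast_lt_top N))
  obtain ⟨d, hd, e, he, hde, hcard⟩ := exists_le_encard_inter_Icc hinf hB N
  have hmany := le_encard_inter_Icc_nsmul hexp hD hμ0 he N d hd (fun b hb h1 h2 b' hb' => by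
    by_contra h
    exact hde b ⟨hb, b', hb', not_le.1 h⟩ h1 h2) hcard
  have hK : 0 < (N + 1) • μ := nsmul_pos hμ0 (by omega)
  -- A stretch avoiding the finitely many gaps above `μ` has `N + 1` points within `N • μ`. So at
  -- the strictly larger scale `(N + 1) • μ` short differences are not few, and the dichotomy forces
  -- few long gaps in every class.
  refine ⟨(N + 1) • μ, hK, fun t c => ?_, ?_⟩
  · rcases hN t c ((N + 1) • μ) with h | h
    · exact Set.encard_lt_top_iff.1 (h.trans (ENat.natCast_lt_top N))
    · refine absurd (hmany.trans ?_) (not_le.2 (h.trans (by exact_mod_cast Nat.lt_succ_self N)))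
      rw [← (sub_left_injective (b := d)).encard_image]
      refine Set.encard_le_encard ?_
      rintro _ ⟨x, ⟨hx, h1, h2⟩, rfl⟩
      refine ⟨d, x, hd, hx, rfl, ?_, ?_⟩
      · exact sub_nonneg.2 h1
      · rw [succ_nsmul]
        show x - d < _
        grind
  · rw [← two_nsmul, ← succ_nsmul, ← mul_nsmul']
    exact finite_shortDiffs_nsmul hexp hD hfin hμ0 hμfin _

end Gaps

/-! ### Return times, their local constancy, and the decomposition -/

section Periods

variable {L : FirstOrder.Language.{u, v}} {R : Type m} [L.Structure R]
  [AddCommGroup R] [LinearOrder R]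

theorem AgreeUpTo.symm {D : Set R} {t d c : R} (h : AgreeUpTo D t d c) : AgreeUpTo D t c d :=
  fun x h1 h2 => (h x h1 h2).symm

theorem AgreeUpTo.trans {D : Set R} {t d c b : R} (h : AgreeUpTo D t d c)
    (h' : AgreeUpTo D t c b) : AgreeUpTo D t d b :=
  fun x h1 h2 => (h x h1 h2).trans (h' x h1 h2)

/-- `h` is the distance of `d` to the next element of its class. -/
def IsReturnTime (D : Set R) (t d h : R) : Prop :=
  (0 < h ∧ d + h ∈ D ∧ AgreeUpTo D t (d + h) d) ∧
    ∀ h', 0 < h' → d + h' ∈ D → AgreeUpTo D t (d + h') d → h ≤ h'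

/-- The elements of `D` with no element of the same class at distance less than `K` above. -/
def badSet (D : Set R) (K : R) : Set R :=
  {d | d ∈ D ∧ ¬ ∃ d', d' ∈ D ∧ d < d' ∧ d' < d + K ∧ AgreeUpTo D (K + K) d' d}

/-- The trace of `D` on the window `[d, d + t]`, moved to `[0, t]`. -/
def windowTrace (D : Set R) (t d : R) : Set R := {z | 0 ≤ z ∧ z ≤ t ∧ d + z ∈ D}

theorem windowTrace_eq_iff {D : Set R} {t d c : R} :
    windowTrace D t d = windowTrace D t c ↔ AgreeUpTo D t d c := by
  constructor
  · intro h x h1 h2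
    have := Set.ext_iff.1 h x
    simpa only [windowTrace, Set.mem_ofPred_eq, h1, h2, true_and] using this
  · intro h
    ext x
    exact and_congr_right fun h1 => and_congr_right fun h2 => h x h1 h2

theorem IsReturnTime.defRel (hexp : ExpandsAddLT L R) {D : Set R} (hD : IsDefinable L D) (t h : R) :
    DefRel L fun v : Fin 1 → R => IsReturnTime D t (v 0) h := by
  unfold IsReturnTime
  apply_rules [AgreeUpTo.defRel hexp hD, DefRel.mem hD, DefRel.and, DefRel.all, DefRel.imp,
    DefRel.lt hexp, DefRel.le hexp, DefFun.add hexp, DefFun.var, DefFun.const]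

theorem isDefinable_badSet (hexp : ExpandsAddLT L R) {D : Set R} (hD : IsDefinable L D) (K : R) :
    IsDefinable L (badSet D K) := by
  apply DefRel.isDefinable
  simp only [badSet, Set.mem_ofPred_eq]
  apply_rules [AgreeUpTo.defRel hexp hD, DefRel.mem hD, DefRel.and, DefRel.ex, DefRel.not,
    DefRel.lt hexp, DefFun.add hexp, DefFun.var, DefFun.const]

theorem IsReturnTime.unique {D : Set R} {t d h h' : R} (hh : IsReturnTime D t d h)
    (hh' : IsReturnTime D t d h') : h = h' :=
  le_antisymm (hh.2 _ hh'.1.1 hh'.1.2.1 hh'.1.2.2) (hh'.2 _ hh.1.1 hh.1.2.1 hh.1.2.2)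

/-- A bad point is either the greatest of its class or begins a gap of length at least `K` in it.
There are finitely many classes, each with finitely many such points. -/
theorem finite_badSet (hexp : ExpandsAddLT L R) {D : Set R} (hD : IsLocallyPseudofinite L D)
    {K : R} (hlong : ∀ c, (longGaps (windowClass D (K + K) c) K).Finite)
    (hfin : (windowTrace D (K + K) '' D).Finite) : (badSet D K).Finite := by
  refine Set.Finite.of_finite_fibers (windowTrace D (K + K))
    (hfin.subset (Set.image_mono fun d hd => hd.1)) ?_
  rintro _ ⟨c, -, rfl⟩
  refine ((hlong c).union (Set.Subsingleton.finite
    (s := {b | IsGreatest (windowClass D (K + K) c) b}) fun x hx y hy => hx.unique hy)).subset ?_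
  rintro d ⟨⟨hd, hbad⟩, htr⟩
  have hdc : AgreeUpTo D (K + K) d c := windowTrace_eq_iff.1 htr
  by_cases hmax : IsGreatest (windowClass D (K + K) c) d
  · exact Or.inr hmax
  · have : ∃ e ∈ windowClass D (K + K) c, d < e := by
      by_contra! h
      exact hmax ⟨⟨hd, hdc⟩, h⟩
    obtain ⟨e, he, hde⟩ := this
    obtain ⟨b, hb, -⟩ := hD.exists_isSucc hexp (E := windowClass D (K + K) c) (fun x hx => hx.1)
      (DefRel.isDefinable
        (mem_windowClass_defRel hexp hD.isDefinable (.const _) (.const _) (.var 0))) he hde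
    refine Or.inl ⟨⟨hd, hdc⟩, b, hb, ?_⟩
    by_contra h
    exact hbad ⟨b, hb.1.1.1, hb.1.2, not_le.1 h, hb.1.1.2.trans hdc.symm⟩

/-- The elements of `D` outside of `badSet D K` in the same class as `x` and not separated from `x`
by elements of `badSet D K`. -/
def piece (D : Set R) (K x : R) : Set R :=
  {y | y ∈ D ∧ y ∉ badSet D K ∧ AgreeUpTo D (K + K) y x ∧
    ∀ b, b ∈ badSet D K → (b < y ↔ b < x)}

theorem isDefinable_piece (hexp : ExpandsAddLT L R) {D : Set R} (hD : IsDefinable L D) (K x : R) :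
    IsDefinable L (piece D K x) := by
  apply DefRel.isDefinable
  simp only [piece, Set.mem_ofPred_eq]
  apply_rules [AgreeUpTo.defRel hexp hD, DefRel.mem hD, DefRel.mem (isDefinable_badSet hexp hD K),
    DefRel.and, DefRel.iff, DefRel.all, DefRel.not, DefRel.imp, DefRel.lt hexp, DefFun.var,
    DefFun.const]

variable [IsOrderedAddMonoid R]

/-- Every trace is a subset of the finite set `shortDiffs D (K + K + K)`, since `K + K < K + K + K`.
-/
theorem finite_image_windowTrace {D : Set R} {K : R} (hK : 0 < K)
    (hfin : (shortDiffs D (K + K + K)).Finite) : (windowTrace D (K + K) '' D).Finite := by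
  refine hfin.finite_subsets.subset ?_
  rintro _ ⟨d, hd, rfl⟩ z ⟨h1, h2, h3⟩
  exact ⟨d, d + z, hd, h3, by grind, h1, by grind⟩

theorem exists_isReturnTime (hexp : ExpandsAddLT L R) {D : Set R}
    (hD : IsLocallyPseudofinite L D) {K d : R} (hd : d ∈ D) (hbad : d ∉ badSet D K) :
    ∃ h, IsReturnTime D (K + K) d h ∧ h < K := by
  have : ∃ d', d' ∈ D ∧ d < d' ∧ d' < d + K ∧ AgreeUpTo D (K + K) d' d := by
    by_contra h
    exact hbad ⟨hd, h⟩
  obtain ⟨e, he, hde, heK, hagree⟩ := this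
  obtain ⟨b, hb, hbe⟩ := hD.exists_isSucc hexp (E := windowClass D (K + K) d) (fun x hx => hx.1)
    (DefRel.isDefinable
      (mem_windowClass_defRel hexp hD.isDefinable (.const _) (.const _) (.var 0))) ⟨he, hagree⟩ hde
  refine ⟨b - d, ⟨⟨sub_pos.2 hb.1.2, by simpa using hb.1.1.1, by simpa using hb.1.1.2⟩,
    fun h' h0 h1 h2 => ?_⟩, by grind⟩
  have := hb.2 ⟨⟨h1, h2⟩, by grind⟩
  grind

/-- Near `d` the set `D` has period `h`, near `d' = d + s` period `h'`, and `s ≤ h` because `d + h ∈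
D`. As `h, h' < K`, windows of length `K + K` overlap enough for each period to transfer to the
other window, and minimality gives both inequalities. -/
theorem IsReturnTime.eq_of_isSucc {D : Set R} {K d d' h h' : R} (hd : IsSucc D d d')
    (hh : IsReturnTime D (K + K) d h) (hK : h < K) (hh' : IsReturnTime D (K + K) d' h')
    (hK' : h' < K) (hdD : d ∈ D) : h = h' := by
  obtain ⟨⟨h0, hmem, hagree⟩, hmin⟩ := hh
  obtain ⟨⟨h0', hmem', hagree'⟩, hmin'⟩ := hh'
  obtain ⟨s, hs⟩ : ∃ s, d' = d + s := ⟨d' - d, by simp⟩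
  subst hs
  have hs0 : 0 < s := by
    have := hd.1.2
    grind
  have hsh : s ≤ h := by
    have := hd.2 ⟨hmem, by grind⟩
    grind
  have key : AgreeUpTo D (K + K) (d + h') d := by
    intro x hx0 hxt
    by_cases hxs : s ≤ x
    · have := hagree' (x - s) (by grind) (by grind)
      rwa [show d + s + h' + (x - s) = d + h' + x by abel, show d + s + (x - s) = d + x by abel]
        at this
    -- Here `d + x` lies below `d + s`, where period `h'` is not yet known: shift up by `h`, apply
    -- `h'`, and shift back down by `h`.
    · have h1 := hagree x hx0 hxt
      have h2 := hagree' (x + h - s) (by grind) (by grind)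
      have h3 := hagree (h' + x) (by grind) (by grind)
      rw [show d + s + h' + (x + h - s) = d + h + (h' + x) by abel,
        show d + s + (x + h - s) = d + h + x by abel] at h2
      rw [show d + (h' + x) = d + h' + x by abel] at h3
      exact h3.symm.trans (h2.trans h1)
  have hle : h ≤ h' := hmin h' h0' (by
    have := key 0 le_rfl (by grind)
    rw [add_zero, add_zero] at this
    exact this.2 hdD) key
  have key' : AgreeUpTo D (K + K) (d + s + h) (d + s) := by
    intro x hx0 hxt
    by_cases hxs : s + x ≤ K + K
    · have := hagree (s + x) (by grind) hxs
      rwa [show d + h + (s + x) = d + s + h + x by abel, show d + (s + x) = d + s + x by abel]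
        at this
    -- Here `d + s + x` lies beyond the window of `d`: shift down by `h'`, apply `h`, and shift back
    -- up by `h'`.
    · have h1 := hagree' (x - h') (by grind) (by grind)
      have h2 := hagree (s + (x - h')) (by grind) (by grind)
      have h3 := hagree' (h + (x - h')) (by grind) (by grind)
      rw [show d + s + h' + (x - h') = d + s + x by abel] at h1
      rw [show d + h + (s + (x - h')) = d + s + (h + (x - h')) by abel,
        show d + (s + (x - h')) = d + s + (x - h') by abel] at h2
      rw [show d + s + h' + (h + (x - h')) = d + s + h + x by abel] at h3
      exact h3.trans (h2.trans h1.symm)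
  refine le_antisymm hle (hmin' h h0 ?_ key')
  have := key' 0 le_rfl (by grind)
  rw [add_zero, add_zero] at this
  exact this.2 hd.1.1

/-- Definable induction along `D`: a least failure `z` has a predecessor `y` with return time `h`,
and `IsReturnTime.eq_of_isSucc` passes `h` on to `z`. -/
theorem IsReturnTime.of_le (hexp : ExpandsAddLT L R) {D : Set R} (hD : IsLocallyPseudofinite L D)
    {K d e h : R} (hd : d ∈ D) (he : e ∈ D) (hde : d ≤ e)
    (hbad : ∀ b ∈ badSet D K, d ≤ b → ¬ b ≤ e) (hh : IsReturnTime D (K + K) d h) :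
    IsReturnTime D (K + K) e h := by
  by_contra hcon
  have hdef : IsDefinable L {x | x ∈ D ∧ d ≤ x ∧ x ≤ e ∧ ¬ IsReturnTime D (K + K) x h} :=
    DefRel.isDefinable (.and (.mem hD.isDefinable (.var 0)) (.and (.le hexp (.const d) (.var 0))
      (.and (.le hexp (.var 0) (.const e)) (DefRel.not (IsReturnTime.defRel hexp hD.isDefinable _ h)))))
  obtain ⟨z, ⟨hz, hdz, hze, hzh⟩, hmin⟩ := hD.exists_isLeast _ (fun x hx => hx.1) hdef
    ⟨e, he, hde, le_rfl, hcon⟩ ⟨d, fun x hx => hx.2.1⟩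
  have hdz' : d < z := hdz.lt_of_ne fun h => hzh (h ▸ hh)
  obtain ⟨y, ⟨hy, hyz⟩, hmax⟩ := hD.exists_isGreatest {x | x ∈ D ∧ x < z} (fun x hx => hx.1)
    (DefRel.isDefinable (.and (.mem hD.isDefinable (.var 0)) (.lt hexp (.var 0) (.const _))))
    ⟨d, hd, hdz'⟩ ⟨z, fun x hx => hx.2.le⟩
  have hdy : d ≤ y := hmax ⟨hd, hdz'⟩
  have hyh : IsReturnTime D (K + K) y h := by
    by_contra hc
    exact absurd (hmin ⟨hy, hdy, by order, hc⟩) (not_le.2 hyz)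
  have hsucc : IsSucc D y z := ⟨⟨hz, hyz⟩, fun c hc => by
    by_contra h
    exact absurd (hmax ⟨hc.1, not_le.1 h⟩) (not_le.2 hc.2)⟩
  obtain ⟨h₁, hh₁, hK₁⟩ := exists_isReturnTime hexp hD hy fun hb => hbad y hb hdy (by order)
  obtain ⟨h₂, hh₂, hK₂⟩ := exists_isReturnTime hexp hD hz fun hb => hbad z hb hdz hze
  obtain rfl := hyh.unique hh₁
  obtain rfl := hyh.eq_of_isSucc hsucc hK₁ hh₂ hK₂ hy
  exact hzh hh₂

/-- The next point of the class of `a` is at most `b`. Since `a` and `b` are good and make the same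
cut in `badSet D K`, no bad point lies between them, so that next point stays in the piece. -/
theorem exists_isReturnTime_isSucc_piece (hexp : ExpandsAddLT L R) {D : Set R}
    (hD : IsLocallyPseudofinite L D) {K x a b : R} (ha : a ∈ piece D K x) (hb : b ∈ piece D K x)
    (hab : a < b) : ∃ h, IsReturnTime D (K + K) a h ∧ IsSucc (piece D K x) a (a + h) := by
  obtain ⟨haD, habad, hax, hacut⟩ := ha
  obtain ⟨hbD, hbbad, hbx, hbcut⟩ := hb
  obtain ⟨h, hh, -⟩ := exists_isReturnTime hexp hD haD habad
  have hmin : ∀ c ∈ piece D K x, a < c → a + h ≤ c := fun c hc hac => by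
    have := hh.2 (c - a) (sub_pos.2 hac) (by simpa using hc.1)
      (by simpa using hc.2.2.1.trans hax.symm)
    grind
  have hhb := hmin b ⟨hbD, hbbad, hbx, hbcut⟩ hab
  have h0 := hh.1.1
  have hah : a < a + h := by grind
  have hcut : ∀ c ∈ badSet D K, a < c → ¬ c ≤ b := fun c hc hac hcb => by
    have hne : c ≠ b := fun h => hbbad (h ▸ hc)
    have := (hacut c hc).2 ((hbcut c hc).1 (lt_of_le_of_ne hcb hne))
    order
  refine ⟨h, hh, ⟨⟨hh.1.2.1, fun hbad => hcut _ hbad hah hhb, hh.1.2.2.trans hax, fun c hc => ?_⟩,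
    hah⟩, fun c hc => hmin c hc.1 hc.2⟩
  rw [← hacut c hc]
  refine ⟨fun h1 => ?_, fun h1 => by order⟩
  by_contra h2
  have hne : c ≠ a := fun h => habad (h ▸ hc)
  exact hcut c hc (lt_of_le_of_ne (not_lt.1 h2) hne.symm) (by order)

theorem isPseudoArithmetic_piece [TopologicalSpace R] (hexp : ExpandsAddLT L R) {D : Set R}
    (hD : IsLocallyPseudofinite L D) (hdisc : IsDiscrete D) {K x : R}
    (hnt : (piece D K x).Nontrivial) : IsPseudoArithmetic (piece D K x) := by
  refine ⟨hdisc.mono fun y hy => hy.1, fun a ha hmax => ?_, ?_⟩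
  · have : ∃ b ∈ piece D K x, a < b := by
      by_contra! h
      exact hmax ⟨ha, h⟩
    obtain ⟨b, hb, hab⟩ := this
    obtain ⟨h, -, hs⟩ := exists_isReturnTime_isSucc_piece hexp hD ha hb hab
    exact ⟨_, hs⟩
  · have hconst : ∀ a ∈ piece D K x, ∀ b ∈ piece D K x, a ≤ b → ∀ c ∈ badSet D K, a ≤ c → ¬ c ≤ b :=
      fun a ha b hb hab c hc hac hcb => by
        have hne : c ≠ b := fun h => hb.2.1 (h ▸ hc)
        have := (ha.2.2.2 c hc).2 ((hb.2.2.2 c hc).1 (lt_of_le_of_ne hcb hne))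
        order
    obtain ⟨a₀, ha₀, b₀, hb₀, hab₀⟩ := hnt.exists_lt
    obtain ⟨h₀, hh₀, hs₀⟩ := exists_isReturnTime_isSucc_piece hexp hD ha₀ hb₀ hab₀
    refine Set.encard_eq_one.2 ⟨h₀, Set.eq_singleton_iff_unique_mem.2
      ⟨⟨a₀, ha₀, _, hs₀, by abel⟩, ?_⟩⟩
    rintro _ ⟨a, ha, b, hs, rfl⟩
    obtain ⟨h, hh, hs'⟩ := exists_isReturnTime_isSucc_piece hexp hD ha hs.1.1 hs.1.2
    have hhh : h = h₀ := by
      rcases le_total a a₀ with hle | hle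
      · exact (hh.of_le hexp hD ha.1 ha₀.1 hle (hconst a ha a₀ ha₀ hle)).unique hh₀
      · exact hh.unique (hh₀.of_le hexp hD ha₀.1 ha.1 hle (hconst a₀ ha₀ a ha hle))
    rw [hs.unique hs', hhh]
    abel

theorem exists_decomposition [TopologicalSpace R] (hexp : ExpandsAddLT L R) {D : Set R}
    (hD : IsLocallyPseudofinite L D) (hdisc : IsDiscrete D) {K : R} (hK : 0 < K)
    (hlong : ∀ t c, (longGaps (windowClass D t c) K).Finite)
    (hshort : (shortDiffs D (K + K + K)).Finite) :
    ∃ (F : Set R) (𝓔 : Set (Set R)), F.Finite ∧ 𝓔.Finite ∧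
      (∀ E ∈ 𝓔, IsDefinable L E ∧ IsPseudoArithmetic E) ∧ D = F ∪ ⋃₀ 𝓔 := by
  have htrace := finite_image_windowTrace hK hshort
  have hbad := finite_badSet hexp hD (hlong _) htrace
  -- The pieces are the fibres of `inv` on the good points, and `inv` takes finitely many values
  -- there. One-point pieces have no gap, so they go into the finite set instead.
  let inv : R → Set R × Set R := fun x =>
    (windowTrace D (K + K) x, {b | b ∈ badSet D K ∧ b < x})
  have hinv : (inv '' (D \ badSet D K)).Finite := by
    refine (htrace.prod hbad.finite_subsets).subset ?_
    rintro _ ⟨x, hx, rfl⟩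
    exact ⟨⟨x, hx.1, rfl⟩, fun b hb => hb.1⟩
  have hpiece : ∀ x, piece D K x = (D \ badSet D K) ∩ inv ⁻¹' {inv x} := fun x => by
    ext y
    simp only [piece, inv, Set.mem_ofPred_eq, Set.mem_inter_iff, Set.mem_sdiff, Set.mem_preimage,
      Set.mem_singleton_iff, Prod.mk.injEq, windowTrace_eq_iff, and_assoc]
    simp only [Set.ext_iff, Set.mem_ofPred_eq, and_congr_right_iff]
  have hmem : ∀ x ∈ D \ badSet D K, x ∈ piece D K x := fun x hx => by
    rw [hpiece]
    exact ⟨hx, rfl⟩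
  refine ⟨badSet D K ∪ {x | x ∈ D \ badSet D K ∧ (piece D K x).Subsingleton},
    {E | (∃ x ∈ D \ badSet D K, E = piece D K x) ∧ E.Nontrivial}, ?_, ?_, ?_, ?_⟩
  · refine hbad.union (Set.Finite.of_finite_fibers inv (hinv.subset (Set.image_mono fun x hx => hx.1)) ?_)
    rintro _ ⟨x, hx, rfl⟩
    refine hx.2.finite.subset fun y hy => ?_
    rw [hpiece]
    exact ⟨hy.1.1, hy.2⟩
  · refine (hinv.image fun v => (D \ badSet D K) ∩ inv ⁻¹' {v}).subset ?_
    rintro _ ⟨⟨x, hx, rfl⟩, -⟩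
    exact ⟨inv x, ⟨x, hx, rfl⟩, (hpiece x).symm⟩
  · rintro _ ⟨⟨x, -, rfl⟩, hnt⟩
    exact ⟨isDefinable_piece hexp hD.isDefinable K x, isPseudoArithmetic_piece hexp hD hdisc hnt⟩
  · ext x
    constructor
    · intro hx
      by_cases hxb : x ∈ badSet D K
      · exact Or.inl (Or.inl hxb)
      rcases (piece D K x).subsingleton_or_nontrivial with h | h
      · exact Or.inl (Or.inr ⟨⟨hx, hxb⟩, h⟩)
      · exact Or.inr ⟨_, ⟨⟨x, ⟨hx, hxb⟩, rfl⟩, h⟩, hmem x ⟨hx, hxb⟩⟩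
    · rintro ((hx | hx) | ⟨_, ⟨⟨y, -, rfl⟩, -⟩, hx⟩)
      · exact hx.1
      · exact hx.1.1
      · exact hx.1

theorem IsDivisible.denselyOrdered (hdiv : IsDivisible R) : DenselyOrdered R := by
  refine ⟨fun a b hab => ?_⟩
  obtain ⟨δ, hδ, h⟩ := hdiv.exists_pos_add_add_lt (sub_pos.2 hab)
  exact ⟨a + δ, by grind, by grind⟩

end Periods

end BurdenTwo

theorem mainTheorem3 (L : FirstOrder.Language.{u, v}) (R : Type m)
    [AddCommGroup R] [LinearOrder R] [IsOrderedAddMonoid R]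
    [TopologicalSpace R] [OrderTopology R] [L.Structure R]
    (hexp : BurdenTwo.ExpandsAddLT L R)
    (hdiv : BurdenTwo.IsDivisible R)
    (hdc : BurdenTwo.IsDefinablyComplete L R)
    (hburden : BurdenTwo.HasBurden (L.completeTheory R) (2 : Cardinal.{0}))
    (D : Set R) (hD : BurdenTwo.IsDefinable L D) (hdisc : IsDiscrete D) :
    ∃ (F : Set R) (𝓔 : Set (Set R)), F.Finite ∧ 𝓔.Finite ∧
      (∀ E ∈ 𝓔, BurdenTwo.IsDefinable L E ∧ BurdenTwo.IsPseudoArithmetic E) ∧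
      D = F ∪ ⋃₀ 𝓔 := by
  by_cases hfin : D.Finite
  · exact ⟨D, ∅, hfin, Set.finite_empty, by simp, by simp⟩
  have hT := BurdenTwo.not_hasInpPattern_three hburden
  have : Nontrivial R := by
    obtain ⟨a, -, b, -, hab⟩ := (Set.not_finite.1 hfin).nontrivial
    exact ⟨a, b, hab⟩
  have := hdiv.denselyOrdered
  have hDl := BurdenTwo.isLocallyPseudofinite_of_isDiscrete hexp hdiv hdc hT hD hdisc
  obtain ⟨K, hK, hlong, hshort⟩ := hDl.exists_scale hexp hT hfin
  exact BurdenTwo.exists_decomposition hexp hDl hdisc hK hlong hshort
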